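/- Let $2\le r\le 9$, $n\ge 1$ and $0\le n_{cp}\le r-1$ be integers. **The scheme.** On a uniform grid of size $\Delta x$ with cells $I_j=[x_{j-1/2},x_{j+1/2}]$ and cell averages $\bar u_j$, let $p_s$ ($0\le s\le r-1$) be the polynomial of degree $\le r-1$ having the averages $\bar u_i$ on the cells $I_i$ of the substencil $S_s=\{I_{j+s-r+1},\dots,I_{j+s}\}$, put $u^s_{j+1/2}=p_s(x_{j+1/2})$, and let $$\beta_s=\sum_{l=1}^{r-1}\Delta x^{2l-1}\int_{x_{j-1/2}}^{x_{j+1/2}}\big(p_s^{(l)}(x)\big)^2dx .$$ The ideal weights are $d_s=\binom rs\binom{r-1}s\big/\binom{2r-1}r$; with them, $\sum_s d_su^s_{j+1/2}$ is the reconstruction on the whole stencil $\{I_{j-r+1},\dots,I_{j+r-1}\}$. For $\varepsilon>0$ the WENO-JS weights are $$\omega^{JS}_s=\frac{\alpha_s}{\sum_l\alpha_l},\qquad \alpha_s=\frac{d_s}{(\varepsilon+\beta_s)^2}.$$ The order-preserving WENO-M mapping is $g(\omega)=g_{d_{k^*}}(\omega)$, where $$g_d(\omega)=\frac{\omega(d+d^2-3d\omega+\omega^2)}{d^2+(1-2d)\omega}$$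 and $k^*$ is the smallest index $k$ that minimizes $|\omega-d_k|$. The weights $\omega_s=\omega_s^{\mathrm{MOP\text{-}M}}$ of the $(2r-1)$th-order MOP-WENO-M scheme with $n$ mappings are obtained from the $\omega^{JS}_s$ by applying $g$ to them $n$ times, with division by the sum of the weights either after every application or only once at the end (the result holds for both). Then $u^-_{j+1/2}=\sum_s\omega_su^s_{j+1/2}$; the value $u^+_{j+1/2}$ is defined by mirror symmetry with respect to $x_{j+1/2}$; and $$\mathcal L(u_j)=-\frac{\hat f_{j+1/2}-\hat f_{j-1/2}}{\Delta x},\qquad \hat f_{j+1/2}=\tfrac12\big[f(u^-_{j+1/2})+f(u^+_{j+1/2})-\alpha\,(u^+_{j+1/2}-u^-_{j+1/2})\big],$$ where $\alpha$ is a real constant. **The result.** Let $u$ be a real function that is smooth near a point $x_c$ and has there a critical point of order $n_{cp}$, that is, $u'(x_c)=\dots=u^{(n_{cp})}(x_c)=0$ and $u^{(n_{cp}+1)}(x_c)\neq0$ (for $n_{cp}=0$: $u'(x_c)\ne0$). Let $f$ be a real function that is smooth near $u(x_c)$, let $\alpha\in\mathbb R$, and let $K$ be a real number. Take for $\bar u_i$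 the exact cell averages of $u$. Then, as $\Delta x\to0$, uniformly over all cells $I_j$ whose centre satisfies $|x_j-x_c|\le K\Delta x$ and over all $\varepsilon>0$, the following hold. 1. For $s=0,\dots,r-1$, $$\omega_s^{\mathrm{MOP\text{-}M}}-d_s=O\big(\Delta x^{\,3^n(r-1-n_{cp})}\big).$$ 2. The scheme converges at the rate $r_c$, in the sense that its truncation error satisfies $$\mathcal L(u_j)-\Big(-\frac1{\Delta x}\int_{x_{j-1/2}}^{x_{j+1/2}}\frac{\partial}{\partial x}f(u(x))\,dx\Big)=O\big(\Delta x^{\,r_c}\big),$$ where $$r_c=\begin{cases}2r-1,& n_{cp}\le\Big\lfloor\dfrac{3^n-1}{3^n}\,r-1\Big\rfloor,\\[2mm](3^n+1)(r-1)-3^n\,n_{cp},& n_{cp}\ge\Big\lfloor\dfrac{3^n-1}{3^n}\,r-1\Big\rfloor+1.\end{cases}$$ The implied constants may depend on $u,f,\alpha,x_c,K,r,n,n_{cp}$, but not on $\Delta x$, $x_j$ or $\varepsilon$. -/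

import Mathlib

open Polynomial Finset

open scoped ContDiff

noncomputable section

namespace WENO

/-! ### Reconstruction from cell averages

All stencils are described in the scaled variable `ξ = (x - x_j) / Δx`: the cell `I_{j+i}` is
`[i - 1/2, i + 1/2]`, and `v i` is the average over this cell (`i : ℤ`). -/

/-- The average of `u` over the cell of size `h` centred at `x`. -/
def cellAverage (u : ℝ → ℝ) (h x : ℝ) : ℝ :=
  (1 / h) * ∫ y in (x - h / 2)..(x + h / 2), u y

/-- The polynomial of degree `< m` whose averages over the `m` consecutive cells
`a, a + 1, …, a + m - 1` are the prescribed ones: the derivative of the polynomial that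
interpolates the primitive `∑ v` at the `m + 1` cell boundaries. -/
def reconPoly (v : ℤ → ℝ) (a : ℤ) (m : ℕ) : ℝ[X] :=
  derivative (Lagrange.interpolate (range (m + 1)) (fun k : ℕ => (a : ℝ) + k - 1 / 2)
    (fun k : ℕ => ∑ i ∈ range k, v (a + i)))

theorem nodes_injOn (a : ℤ) (m : ℕ) :
    Set.InjOn (fun k : ℕ => (a : ℝ) + k - 1 / 2) (range (m + 1) : Finset ℕ) := by
  intro x _ y _ h
  have : (x : ℝ) = y := by simpa using h
  exact_mod_cast this

/-- `reconPoly v a m` has degree `< m`. -/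
theorem reconPoly_degree_lt (v : ℤ → ℝ) (a : ℤ) (m : ℕ) :
    (reconPoly v a m).degree < m := by
  have h1 := Lagrange.degree_interpolate_lt (fun k : ℕ => ∑ i ∈ range k, v (a + i))
    (nodes_injOn a m)
  rw [card_range] at h1
  rw [reconPoly]
  generalize Lagrange.interpolate (range (m + 1)) (fun k : ℕ => (a : ℝ) + k - 1 / 2)
    (fun k : ℕ => ∑ i ∈ range k, v (a + i)) = P at h1
  by_cases h0 : P = 0
  · simp [h0, bot_lt_iff_ne_bot]
  · have h2 := degree_derivative_lt h0
    rw [degree_eq_natDegree h0] at h1 h2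
    have h3 : natDegree P < m + 1 := by exact_mod_cast h1
    exact lt_of_lt_of_le h2 (by exact_mod_cast Nat.lt_succ_iff.mp h3)

/-- `reconPoly v a m` has the prescribed averages over the cells `a, …, a + m - 1`. -/
theorem integral_reconPoly (v : ℤ → ℝ) (a : ℤ) (m i : ℕ) (hi : i < m) :
    ∫ x in ((a : ℝ) + i - 1 / 2)..((a : ℝ) + i + 1 / 2), (reconPoly v a m).eval x = v (a + i) := by
  rw [reconPoly, intervalIntegral.integral_eq_sub_of_hasDerivAt
    (fun x _ => Polynomial.hasDerivAt _ x) ((Polynomial.continuous _).intervalIntegrable _ _)]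
  have e1 := Lagrange.eval_interpolate_at_node (fun k : ℕ => ∑ i ∈ range k, v (a + i))
    (nodes_injOn a m) (i := i) (by simp; omega)
  have e2 := Lagrange.eval_interpolate_at_node (fun k : ℕ => ∑ i ∈ range k, v (a + i))
    (nodes_injOn a m) (i := i + 1) (by simp; omega)
  have e3 : (a : ℝ) + i + 1 / 2 = a + ((i + 1 : ℕ) : ℝ) - 1 / 2 := by push_cast; ring
  rw [e3, e1, e2, sum_range_succ]
  ring

/-- The polynomial of the substencil `S_s = {I_{j+s-r+1}, …, I_{j+s}}`. -/
def subPoly (r : ℕ) (v : ℤ → ℝ) (s : ℕ) : ℝ[X] :=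
  reconPoly v ((s : ℤ) - r + 1) r

/-- The `r`-th order approximation of `u(x_{j+1/2})` on the substencil `S_s`. -/
def subValue (r : ℕ) (v : ℤ → ℝ) (s : ℕ) : ℝ :=
  (subPoly r v s).eval (1 / 2)

/-- The smoothness indicator
`β_s = ∑_{l=1}^{r-1} Δx^{2l-1} ∫_{x_{j-1/2}}^{x_{j+1/2}} (p_s^{(l)}(x))² dx`,
written in the scaled variable, in which the powers of `Δx` cancel. -/
def smoothnessIndicator (r : ℕ) (v : ℤ → ℝ) (s : ℕ) : ℝ :=
  ∑ l ∈ Icc 1 (r - 1), ∫ ξ in (-(1 / 2 : ℝ))..(1 / 2),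
    ((derivative^[l] (subPoly r v s)).eval ξ) ^ 2

/-- The ideal weights `d_0, …, d_{r-1}`: those for which `∑ d_s u^s_{j+1/2}` is the central
upstream reconstruction on the whole `(2r-1)`-cell stencil (see `sum_idealWeight_mul_subValue`).
For `r = 3` they are `1/10, 6/10, 3/10`. -/
def idealWeight (r s : ℕ) : ℝ :=
  (r.choose s * (r - 1).choose s : ℝ) / (2 * r - 1).choose r

theorem sum_choose_succ (a : ℕ) (G : ℕ → ℝ) :
    ∑ s ∈ range (a + 2), ((a + 1).choose s : ℝ) * G s
      = ∑ s ∈ range (a + 1), (a.choose s : ℝ) * (G s + G (s + 1)) := by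
  rw [sum_range_succ']
  simp only [Nat.choose_succ_succ, Nat.cast_add, add_mul, sum_add_distrib, mul_add]
  have h := sum_range_succ' (fun s => (a.choose s : ℝ) * G s) (a + 1)
  rw [sum_range_succ] at h
  simp at h ⊢
  linarith

theorem sum_choose_mul_choose (a b : ℕ) (F : ℕ → ℝ) :
    ∑ s ∈ range (a + 1), ∑ k ∈ range (b + 1), (a.choose s : ℝ) * b.choose k * F (s + k)
      = ∑ q ∈ range (a + b + 1), ((a + b).choose q : ℝ) * F q := by
  induction a generalizing F with
  | zero => simp
  | succ a ih =>
    have h := sum_choose_succ a (fun s => ∑ k ∈ range (b + 1), (b.choose k : ℝ) * F (s + k))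
    have h2 := ih (fun q => F q + F (q + 1))
    have h3 := sum_choose_succ (a + b) F
    rw [show a + 1 + b + 1 = a + b + 2 by ring, show a + 1 + b = a + b + 1 by ring, h3, ← h2]
    simp only [mul_assoc, ← mul_sum]
    rw [h]
    refine sum_congr rfl fun s _ => ?_
    rw [← sum_add_distrib]
    congr 1
    refine sum_congr rfl fun k _ => ?_
    rw [show s + 1 + k = s + k + 1 by ring]
    ring

theorem prod_nodes (m k : ℕ) (hk : k ≤ m) :
    ∏ j ∈ (range (m + 1)).erase k, ((k : ℝ) - j) = (-1) ^ (m - k) * k.factorial * (m - k).factorial := by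
  induction m, hk using Nat.le_induction with
  | base =>
    have : (range (k + 1)).erase k = range k := by ext; simp; omega
    rw [this, ← prod_range_reflect, ← prod_range_add_one_eq_factorial]
    simp only [Nat.sub_self, pow_zero, Nat.factorial_zero, Nat.cast_one, one_mul, mul_one,
      Nat.cast_prod]
    refine prod_congr rfl fun j hj => ?_
    have := mem_range.mp hj
    rw [Nat.sub_sub, Nat.cast_sub (by omega)]
    push_cast; ring
  | succ m hk ih =>
    have : (range (m + 1 + 1)).erase k = insert (m + 1) ((range (m + 1)).erase k) := by
      ext; simp; omega
    rw [this, prod_insert (by simp), ih, Nat.succ_sub hk, Nat.factorial_succ, pow_succ]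
    push_cast [Nat.cast_sub hk]
    ring

theorem eval_derivative_basis (a : ℤ) (m p k : ℕ) (hp : p ≤ m) (hk : k ≤ m) (hkp : k ≠ p) :
    (derivative (Lagrange.basis (range (m + 1)) (fun k : ℕ => (a : ℝ) + k - 1 / 2) k)).eval
      ((a : ℝ) + p - 1 / 2)
      = (-1) ^ (k + p) * (m.choose k / m.choose p) * ((p : ℝ) - k)⁻¹ := by
  have hd : (p : ℝ) - k ≠ 0 := by
    rw [sub_ne_zero]; exact_mod_cast hkp.symm
  have hp' : p ∈ (range (m + 1)).erase k := by simp; omega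
  have hk' : k ∈ (range (m + 1)).erase p := by simp; omega
  have h1 := prod_nodes m p hp
  have h2 := prod_nodes m k hk
  rw [← mul_prod_erase _ _ hk'] at h1
  rw [← mul_prod_erase _ _ hp', erase_right_comm] at h2
  rw [Lagrange.basis, ← mul_prod_erase _ _ hp', derivative_mul, eval_add, eval_mul, eval_mul,
    Lagrange.eval_basisDivisor_right, zero_mul, add_zero, eval_prod, erase_right_comm]
  simp only [Lagrange.basisDivisor, derivative_mul, derivative_C, derivative_sub, derivative_X,
    eval_mul, eval_C, eval_sub, eval_X, zero_mul, zero_add, sub_zero, mul_one]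
  rw [prod_mul_distrib, prod_inv_distrib]
  have e1 : ∀ x y : ℕ, (a : ℝ) + x - 1 / 2 - (a + y - 1 / 2) = x - y := by intros; ring
  simp only [e1]
  have hd' : (k : ℝ) - p ≠ 0 := by
    rw [sub_ne_zero]; exact_mod_cast hkp
  have e2 := eq_div_of_mul_eq hd' ((mul_comm _ _).trans h2)
  have e3 := eq_div_of_mul_eq hd ((mul_comm _ _).trans h1)
  rw [e2, e3, Nat.cast_choose ℝ hk, Nat.cast_choose ℝ hp]
  have f : ∀ j : ℕ, (j.factorial : ℝ) ≠ 0 := fun j => by exact_mod_cast j.factorial_ne_zero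
  have := f k; have := f p; have := f m; have := f (m - k); have := f (m - p)
  have g : ∀ j : ℕ, ((-1 : ℝ)) ^ j ≠ 0 := fun j => by simp
  have hs : ((-1 : ℝ)) ^ (m - p) = (-1) ^ (k + p) * (-1) ^ (m - k) := by
    rw [← pow_add, show k + p + (m - k) = (m - p) + 2 * p by omega, pow_add _ (m - p), pow_mul]
    simp
  rw [hs]
  have := g (m - k)
  field_simp

theorem eval_reconPoly_edge (v : ℤ → ℝ) (a : ℤ) (m p : ℕ) (hp : p ≤ m) :
    (reconPoly v a m).eval ((a : ℝ) + p - 1 / 2)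
      = ∑ k ∈ range (m + 1), (-1) ^ (k + p) * (m.choose k / m.choose p) * ((p : ℝ) - k)⁻¹
          * (∑ i ∈ range k, v (a + i) - ∑ i ∈ range p, v (a + i)) := by
  set Y : ℕ → ℝ := fun k => ∑ i ∈ range k, v (a + i) with hY
  have h0 : Lagrange.interpolate (range (m + 1)) (fun k : ℕ => (a : ℝ) + k - 1 / 2) Y
      = Lagrange.interpolate (range (m + 1)) (fun k : ℕ => (a : ℝ) + k - 1 / 2)
          (fun k => Y k - Y p) + C (Y p) := by
    have e := Lagrange.sum_basis (nodes_injOn a m) ⟨0, by simp⟩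
    simp only [Lagrange.interpolate_apply, C_sub, sub_mul, sum_sub_distrib, ← mul_sum, e]
    ring
  rw [reconPoly, ← hY, h0, derivative_add, derivative_C, add_zero, Lagrange.interpolate_apply,
    derivative_sum, eval_finsetSum]
  refine sum_congr rfl fun k hk => ?_
  by_cases hkp : k = p
  · simp [hkp]
  · rw [derivative_mul, derivative_C, zero_mul, zero_add, eval_mul, eval_C,
      eval_derivative_basis a m p k hp (by simpa [Nat.lt_succ_iff] using hk) hkp]
    ring

/-- The defining property of the ideal weights: the combination of the approximations on the
substencils is the approximation on the stencil `{I_{j-r+1}, …, I_{j+r-1}}`. -/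
theorem sum_idealWeight_mul_subValue (r : ℕ) (hr : 1 ≤ r) (v : ℤ → ℝ) :
    ∑ s ∈ range r, idealWeight r s * subValue r v s
      = (reconPoly v (1 - r) (2 * r - 1)).eval (1 / 2) := by
  set Y : ℕ → ℝ := fun k => ∑ i ∈ range k, v (1 - r + i) with hY
  set F : ℕ → ℝ := fun q => (-1) ^ (q + r) / (2 * r - 1).choose r * ((r : ℝ) - q)⁻¹ * (Y q - Y r)
    with hF
  have hG := eval_reconPoly_edge v (1 - r) (2 * r - 1) r (by omega)
  rw [show (((1 - r : ℤ) : ℝ)) + r - 1 / 2 = 1 / 2 by push_cast; ring] at hG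
  have hV := sum_choose_mul_choose (r - 1) r F
  rw [show r - 1 + r = 2 * r - 1 by omega, show r - 1 + 1 = r by omega] at hV
  have hGF : (reconPoly v (1 - r) (2 * r - 1)).eval (1 / 2)
      = ∑ q ∈ range (2 * r - 1 + 1), ((2 * r - 1).choose q : ℝ) * F q := by
    rw [hG]
    refine sum_congr rfl fun k _ => ?_
    simp only [hF, hY]
    ring
  rw [hGF, ← hV]
  refine sum_congr rfl fun s hs => ?_
  have hs' : s < r := mem_range.mp hs
  have hsub := eval_reconPoly_edge v ((s : ℤ) - r + 1) r (r - s) (by omega)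
  rw [show ((((s : ℤ) - r + 1 : ℤ) : ℝ)) + ((r - s : ℕ) : ℝ) - 1 / 2 = 1 / 2 by
    push_cast [Nat.cast_sub hs'.le]; ring] at hsub
  rw [subValue, subPoly, hsub, mul_sum]
  refine sum_congr rfl fun k _ => ?_
  have hYs : ∀ k : ℕ, ∑ i ∈ range k, v ((s : ℤ) - r + 1 + i) = Y (s + k) - Y s := by
    intro k
    simp only [hY, sum_range_add, add_sub_cancel_left]
    refine sum_congr rfl fun i _ => ?_
    congr 1
    push_cast; ring
  rw [hYs, hYs, show s + (r - s) = r by omega, Nat.choose_symm hs'.le]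
  have hc : (r.choose s : ℝ) ≠ 0 := by exact_mod_cast (Nat.choose_pos hs'.le).ne'
  have hsgn : ((-1 : ℝ)) ^ (k + (r - s)) = (-1) ^ (s + k + r) := by
    rw [show s + k + r = k + (r - s) + 2 * s by omega, pow_add _ (k + (r - s)), pow_mul]
    simp
  rw [hsgn]
  simp only [hF, idealWeight]
  push_cast [Nat.cast_sub hs'.le]
  rw [show (r : ℝ) - s - k = r - (s + k) by ring]
  field_simp
  ring

/-! ### Nonlinear weights -/

/-- Division of `α_0, …, α_{r-1}` by their sum. -/
def normalizeWeights (r : ℕ) (α : ℕ → ℝ) (s : ℕ) : ℝ :=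
  α s / ∑ l ∈ range r, α l

/-- The WENO-JS weights: normalization of `α_s = d_s / (ε + β_s)²`. -/
def jsWeight (r : ℕ) (ε : ℝ) (v : ℤ → ℝ) : ℕ → ℝ :=
  normalizeWeights r fun s => idealWeight r s / (ε + smoothnessIndicator r v s) ^ 2

/-- The WENO-M mapping function with parameter `d`. -/
def mapM (d w : ℝ) : ℝ :=
  w * (d + d ^ 2 - 3 * d * w + w ^ 2) / (d ^ 2 + (1 - 2 * d) * w)

/-- `k* = min (IndexOf (min {|w - d_0|, …, |w - d_{r-1}|}))`. -/
def minDistIndex (r : ℕ) (d : ℕ → ℝ) (w : ℝ) : ℕ :=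
  sInf {k : ℕ | k < r ∧ ∀ i < r, |w - d k| ≤ |w - d i|}

/-- `minDist (x_0, …, x_{r-1}; d_0, …, d_{r-1}; w) = x_{k*}`. -/
def minDist (r : ℕ) (x d : ℕ → ℝ) (w : ℝ) : ℝ :=
  x (minDistIndex r d w)

/-- The order-preserving mapping function of the MOP-WENO-M scheme: the WENO-M mapping whose
parameter is the ideal weight nearest to `w` (it is the same function of `w` for all `s`). -/
def mopMapM (r : ℕ) (w : ℝ) : ℝ :=
  mapM (minDist r (idealWeight r) (idealWeight r) w) w

/-- MOP-WENO-M weights with `n` mappings, each one followed by a normalization, starting from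
the WENO-JS weights. -/
def mopWeightRenorm (r n : ℕ) (ε : ℝ) (v : ℤ → ℝ) : ℕ → ℝ :=
  (fun w : ℕ → ℝ => normalizeWeights r fun s => mopMapM r (w s))^[n] (jsWeight r ε v)

/-- MOP-WENO-M weights with `n` mappings applied in succession to the WENO-JS weights, and one
normalization at the end. -/
def mopWeight (r n : ℕ) (ε : ℝ) (v : ℤ → ℝ) : ℕ → ℝ :=
  normalizeWeights r fun s => (mopMapM r)^[n] (jsWeight r ε v s)

/-! ### The semi-discrete finite volume scheme

`W v s` is the weight of the substencil `S_s` for the cell averages `v`. -/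

/-- The weighted average `∑ ω_s u^s_{j+1/2}`. -/
def recon (r : ℕ) (W : (ℤ → ℝ) → ℕ → ℝ) (v : ℤ → ℝ) : ℝ :=
  ∑ s ∈ range r, W v s * subValue r v s

/-- The cell averages of `u` on the uniform grid of size `h`, numbered relatively to the cell
with centre `x`. -/
def averages (u : ℝ → ℝ) (h x : ℝ) (i : ℤ) : ℝ :=
  cellAverage u h (x + i * h)

/-- The left-biased value `u⁻_{j+1/2}`, where `x = x_j`. -/
def uMinus (r : ℕ) (W : (ℤ → ℝ) → ℕ → ℝ) (u : ℝ → ℝ) (h x : ℝ) : ℝ :=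
  recon r W (averages u h x)

/-- The right-biased value `u⁺_{j+1/2}`, where `x = x_j`: the mirror image of the left-biased
one with respect to `x_{j+1/2}`, which exchanges the cells `I_{j+i}` and `I_{j+1-i}`. -/
def uPlus (r : ℕ) (W : (ℤ → ℝ) → ℕ → ℝ) (u : ℝ → ℝ) (h x : ℝ) : ℝ :=
  recon r W fun i => averages u h x (1 - i)

/-- The global Lax-Friedrichs flux with constant `α`. -/
def laxFriedrichs (f : ℝ → ℝ) (α a b : ℝ) : ℝ :=
  (1 / 2) * (f a + f b - α * (b - a))

/-- The numerical flux at `x_{j+1/2}`, where `x = x_j`. -/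
def numFlux (r : ℕ) (W : (ℤ → ℝ) → ℕ → ℝ) (f : ℝ → ℝ) (α : ℝ) (u : ℝ → ℝ) (h x : ℝ) : ℝ :=
  laxFriedrichs f α (uMinus r W u h x) (uPlus r W u h x)

/-- The spatial operator `L(u_j) = -(F_{j+1/2} - F_{j-1/2}) / Δx`, where `x = x_j`. -/
def spatialOperator (r : ℕ) (W : (ℤ → ℝ) → ℕ → ℝ) (f : ℝ → ℝ) (α : ℝ) (u : ℝ → ℝ)
    (h x : ℝ) : ℝ :=
  -(1 / h) * (numFlux r W f α u h x - numFlux r W f α u h (x - h))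

/-- The error of the spatial operator at the cell with centre `x`, against the exact value of
`d ū_j / dt` for `u_t + f(u)_x = 0`, namely minus the cell average of `f(u)_x`. -/
def truncationError (r : ℕ) (W : (ℤ → ℝ) → ℕ → ℝ) (f : ℝ → ℝ) (α : ℝ) (u : ℝ → ℝ)
    (h x : ℝ) : ℝ :=
  spatialOperator r W f α u h x - -cellAverage (deriv fun y => f (u y)) h x

/-! ### Critical points and the rate of convergence -/

/-- `u' = … = u^{(m)} = 0` and `u^{(m+1)} ≠ 0` at `z`; for `m = 0` just `u'(z) ≠ 0`. -/
def IsCriticalOfOrder (u : ℝ → ℝ) (z : ℝ) (m : ℕ) : Prop :=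
  (∀ k, 1 ≤ k → k ≤ m → iteratedDeriv k u z = 0) ∧ iteratedDeriv (m + 1) u z ≠ 0

/-- The rate of convergence; it is used for `m ≤ r - 1`, where no subtraction truncates. -/
def convergenceRate (r n m : ℕ) : ℕ :=
  if (m : ℤ) ≤ ⌊((3 : ℝ) ^ n - 1) / 3 ^ n * r - 1⌋ then 2 * r - 1
  else (3 ^ n + 1) * (r - 1) - 3 ^ n * m

end WENO

end

noncomputable section

namespace WENO

open Filter Topology Asymptotics

/-! ### The reconstruction polynomial as a linear function of the averages -/

/-! Every estimate is an `O` along the single filter `gridFilter`, so uniformity in the cell and in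
`ε` is built in. Cells at distance `O(h)` from `z` see `u` as its Taylor polynomial at `z`, which in
the cell variable becomes a polynomial `q`. Reconstruction is linear, bounded and exact on low
degrees, so its output differs from that for `q` by the Taylor remainder.

Weights. With the Taylor polynomial of degree `< r`, all substencils reconstruct the same `q`. Its
derivatives are `O(h^(m+1))` and the derivative of order `m+1` is bounded below by a multiple of
`h^(m+1)`. So if `m + 1 < r`, all `β_s` equal one `B ≥ c h^(2(m+1))` up to `O(h^(r+m+1))`: a
relative error `O(h^(r-1-m))` (`exists_smoothnessIndicator_sub_isBigO`). The JS weights inherit this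
order, since adding `ε` only reduces the relative error. The mapping has contact of order three with
the constant `d_s` at `d_s`, so each application triples the order (`mop_weights_sub_isBigO`). For
`m = r - 1` the claim is mere boundedness.

Edge values. Both weight families have sum `1`, so the nonlinear value is the full-stencil one plus
`∑ (ω_s - d_s)(u^s - u)`. The sum is `O(h^(3^n(r-1-m)+r))`, while the full stencil has error `e
h^(2r-1) + O(h^(2r))` with `e` independent of the cell (`exists_uMinus_sub_isBigO`; the right-biased
value follows by reflection).

Division by `h`. The flux difference must be one order better than the rate. The term `e h^(2r-1)`
is too large, but it is the same at both edges of a cell; its effect on the flux difference is a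
second difference of `f`, which gains the missing factor `h` (`second_difference_isBigO`,
`edge_difference_isBigO`). -/

theorem reconPoly_sub (v w : ℤ → ℝ) (a : ℤ) (m : ℕ) :
    reconPoly (fun i => v i - w i) a m = reconPoly v a m - reconPoly w a m := by
  have h : (fun k : ℕ => ∑ i ∈ range k, (v (a + i) - w (a + i)))
      = (fun k : ℕ => ∑ i ∈ range k, v (a + i)) - fun k : ℕ => ∑ i ∈ range k, w (a + i) := by
    ext k; simp
  rw [reconPoly, reconPoly, reconPoly, h, map_sub, derivative_sub]

theorem reconPoly_const_mul (c : ℝ) (v : ℤ → ℝ) (a : ℤ) (m : ℕ) :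
    reconPoly (fun i => c * v i) a m = C c * reconPoly v a m := by
  have h : (fun k : ℕ => ∑ i ∈ range k, c * v (a + i))
      = c • fun k : ℕ => ∑ i ∈ range k, v (a + i) := by
    ext k; simp [mul_sum]
  rw [reconPoly, reconPoly, h, map_smul, derivative_smul, smul_eq_C_mul]

theorem exists_derivative_eq (q : ℝ[X]) (m : ℕ) (hq : q.degree < m) :
    ∃ Q : ℝ[X], derivative Q = q ∧ Q.degree < (m + 1 : ℕ) := by
  refine ⟨∑ k ∈ range m, monomial (k + 1) (q.coeff k / (k + 1)), ?_, ?_⟩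
  · ext j
    rw [derivative_sum, finsetSum_coeff]
    simp only [derivative_monomial, coeff_monomial, Nat.add_sub_cancel]
    have h : ∀ k : ℕ, q.coeff k / (k + 1) * ((k + 1 : ℕ) : ℝ) = q.coeff k := fun k => by
      have : (k : ℝ) + 1 ≠ 0 := by positivity
      push_cast; field_simp
    simp only [h, sum_ite_eq', mem_range]
    split_ifs with hj
    · rfl
    · exact (coeff_eq_zero_of_degree_lt (hq.trans_le (by exact_mod_cast not_lt.mp hj))).symm
  · rw [degree_lt_iff_coeff_zero]
    intro j hj
    rw [finsetSum_coeff]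
    refine sum_eq_zero fun k hk => ?_
    rw [coeff_monomial, if_neg]
    have := mem_range.mp hk
    omega

/-- The averages of the polynomial `q` over the cells `[i - 1/2, i + 1/2]`. -/
def polyAverages (q : ℝ[X]) (i : ℤ) : ℝ :=
  ∫ ξ in ((i : ℝ) - 1 / 2)..(i + 1 / 2), q.eval ξ

theorem polyAverages_derivative (Q : ℝ[X]) (i : ℤ) :
    polyAverages (derivative Q) i = Q.eval ((i : ℝ) + 1 / 2) - Q.eval ((i : ℝ) - 1 / 2) := by
  rw [polyAverages, intervalIntegral.integral_eq_sub_of_hasDerivAt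
    (fun x _ => Polynomial.hasDerivAt _ x) ((Polynomial.continuous _).intervalIntegrable _ _)]

theorem polyAverages_sub (p q : ℝ[X]) (i : ℤ) :
    polyAverages (p - q) i = polyAverages p i - polyAverages q i := by
  simp only [polyAverages, eval_sub]
  exact intervalIntegral.integral_sub ((Polynomial.continuous _).intervalIntegrable _ _)
    ((Polynomial.continuous _).intervalIntegrable _ _)

theorem polyAverages_C_mul (c : ℝ) (q : ℝ[X]) (i : ℤ) :
    polyAverages (C c * q) i = c * polyAverages q i := by
  simp only [polyAverages, eval_mul, eval_C, intervalIntegral.integral_const_mul]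

/-- The reconstruction on `m` cells is exact for polynomials of degree `< m`. -/
theorem reconPoly_polyAverages (q : ℝ[X]) (a : ℤ) (m : ℕ) (hq : q.degree < m) :
    reconPoly (polyAverages q) a m = q := by
  obtain ⟨Q, rfl, hQ⟩ := exists_derivative_eq q m hq
  have hsum : ∀ k : ℕ, ∑ i ∈ range k, polyAverages (derivative Q) (a + i)
      = Q.eval ((a : ℝ) + k - 1 / 2) - Q.eval ((a : ℝ) - 1 / 2) := by
    intro k
    induction k with
    | zero => simp
    | succ k ih =>
      rw [sum_range_succ, ih, polyAverages_derivative]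
      push_cast
      ring_nf
  -- The partial sums of the averages telescope to values of the primitive at the cell edges, so the
  -- primitive, shifted to vanish at the first edge, is its own interpolant.
  have hI : Q - C (Q.eval ((a : ℝ) - 1 / 2))
      = Lagrange.interpolate (range (m + 1)) (fun k : ℕ => (a : ℝ) + k - 1 / 2)
        (fun k : ℕ => ∑ i ∈ range k, polyAverages (derivative Q) (a + i)) := by
    refine Lagrange.eq_interpolate_of_eval_eq _ (nodes_injOn a m) ?_ fun k _ => ?_
    · rw [card_range]
      refine (degree_sub_le _ _).trans_lt (max_lt hQ (degree_C_le.trans_lt ?_))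
      exact_mod_cast Nat.succ_pos m
    · rw [hsum, eval_sub, eval_C]
  rw [reconPoly, ← hI, derivative_sub, derivative_C, sub_zero]

/-- The reconstruction is bounded by the averages, together with its derivatives. -/
theorem exists_abs_eval_reconPoly_le (a : ℤ) (m l : ℕ) :
    ∃ C : ℝ, ∀ (v : ℤ → ℝ) (δ : ℝ), (∀ i : ℕ, i < m → |v (a + i)| ≤ δ) →
      ∀ ξ ∈ Set.Icc (-(1 / 2) : ℝ) (1 / 2), |(derivative^[l] (reconPoly v a m)).eval ξ| ≤ C * δ := by
  have hB : ∀ k : ℕ, ∃ M : ℝ, ∀ ξ ∈ Set.Icc (-(1 / 2) : ℝ) (1 / 2),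
      |(derivative^[l] (derivative (Lagrange.basis (range (m + 1))
        (fun k : ℕ => (a : ℝ) + k - 1 / 2) k))).eval ξ| ≤ M := fun k => by
    simpa using isCompact_Icc.exists_bound_of_continuousOn
      (Polynomial.continuous (derivative^[l] (derivative (Lagrange.basis (range (m + 1))
        (fun k : ℕ => (a : ℝ) + k - 1 / 2) k)))).continuousOn
  choose M hM using hB
  refine ⟨∑ k ∈ range (m + 1), k * M k, fun v δ hv ξ hξ => ?_⟩
  rw [reconPoly, Lagrange.interpolate_apply, derivative_sum, Polynomial.iterate_derivative_sum,
    eval_finsetSum, sum_mul]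
  refine (abs_sum_le_sum_abs _ _).trans (sum_le_sum fun k hk => ?_)
  have hk' : k ≤ m := Nat.lt_succ_iff.mp (mem_range.mp hk)
  rw [derivative_C_mul, iterate_derivative_C_mul, eval_mul, eval_C, abs_mul]
  have h1 : |∑ i ∈ range k, v (a + i)| ≤ k * δ := by
    refine (abs_sum_le_sum_abs _ _).trans ?_
    refine (sum_le_sum fun i hi => hv i ((mem_range.mp hi).trans_le hk')).trans ?_
    simp
  calc _ ≤ (k * δ) * M k := mul_le_mul h1 (hM k ξ hξ) (abs_nonneg _) ((abs_nonneg _).trans h1)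
    _ = _ := by ring

/-! ### Grids that shrink to a point -/

/-- The limit `h → 0` of triples `(h, x, ε)` with `|x - z| ≤ K h` and `ε > 0`, uniformly in `x`
and `ε`. -/
def gridFilter (z K : ℝ) : Filter (ℝ × ℝ × ℝ) :=
  comap Prod.fst (𝓝[>] 0) ⊓ 𝓟 {p | |p.2.1 - z| ≤ K * p.1 ∧ 0 < p.2.2}

theorem eventually_gridFilter {z K : ℝ} {P : ℝ × ℝ × ℝ → Prop} :
    (∀ᶠ p in gridFilter z K, P p) ↔ ∃ h₀ > 0, ∀ h x ε : ℝ, 0 < h → h < h₀ → |x - z| ≤ K * h →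
      0 < ε → P (h, x, ε) := by
  rw [gridFilter, eventually_inf_principal, eventually_comap,
    (nhdsGT_basis (0 : ℝ)).eventually_iff]
  constructor
  · rintro ⟨h₀, h0, H⟩
    exact ⟨h₀, h0, fun h x ε h1 h2 h3 h4 => H ⟨h1, h2⟩ (h, x, ε) rfl ⟨h3, h4⟩⟩
  · rintro ⟨h₀, h0, H⟩
    refine ⟨h₀, h0, ?_⟩
    rintro h ⟨h1, h2⟩ ⟨h', x, ε⟩ rfl ⟨h3, h4⟩
    exact H h' x ε h1 h2 h3 h4

theorem eventually_mem_gridFilter (z K : ℝ) : ∀ᶠ p in gridFilter z K,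
    0 < p.1 ∧ p.1 < 1 ∧ |p.2.1 - z| ≤ K * p.1 ∧ 0 < p.2.2 :=
  eventually_gridFilter.mpr ⟨1, one_pos, fun _ _ _ h1 h2 h3 h4 => ⟨h1, h2, h3, h4⟩⟩

theorem tendsto_fst_gridFilter (z K : ℝ) : Tendsto Prod.fst (gridFilter z K) (𝓝 0) :=
  (tendsto_comap.mono_left inf_le_left).mono_right nhdsWithin_le_nhds

theorem isBigO_gridFilter_iff {z K : ℝ} {F : ℝ × ℝ × ℝ → ℝ} {N : ℕ} :
    F =O[gridFilter z K] (fun p => p.1 ^ N) ↔ ∃ C : ℝ, ∃ h₀ > 0, ∀ h x ε : ℝ, 0 < h → h < h₀ →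
      |x - z| ≤ K * h → 0 < ε → |F (h, x, ε)| ≤ C * h ^ N := by
  rw [isBigO_iff]
  refine exists_congr fun C => ?_
  rw [eventually_gridFilter]
  refine exists_congr fun h₀ => and_congr_right fun _ => ?_
  refine forall_congr' fun h => forall_congr' fun x => forall_congr' fun ε => ?_
  refine forall_congr' fun h1 => ?_
  rw [Real.norm_eq_abs, Real.norm_eq_abs, abs_of_pos (pow_pos h1 N)]

theorem isBigO_pow_gridFilter (z K : ℝ) {M N : ℕ} (h : M ≤ N) :
    (fun p : ℝ × ℝ × ℝ => p.1 ^ N) =O[gridFilter z K] fun p => p.1 ^ M := by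
  refine .of_bound' ((eventually_mem_gridFilter z K).mono fun p hp => ?_)
  rw [Real.norm_eq_abs, Real.norm_eq_abs, abs_of_pos (pow_pos hp.1 _), abs_of_pos (pow_pos hp.1 _)]
  exact pow_le_pow_of_le_one hp.1.le hp.2.1.le h

/-- Estimates at the left edge of a cell come from the left neighbour, whose centre is within `(K +
1) h` of `z`. This is why the edge estimates are needed for every `K`. -/
theorem tendsto_shift_gridFilter (z K : ℝ) :
    Tendsto (fun p : ℝ × ℝ × ℝ => (p.1, p.2.1 - p.1, p.2.2)) (gridFilter z K)
      (gridFilter z (K + 1)) := by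
  intro s hs
  obtain ⟨h₀, h0, H⟩ := eventually_gridFilter.mp (show ∀ᶠ p in _, p ∈ s from hs)
  refine eventually_gridFilter.mpr ⟨h₀, h0, fun h x ε h1 h2 h3 h4 => H _ _ _ h1 h2 ?_ h4⟩
  have := abs_sub_le_iff.mp h3
  rw [abs_sub_le_iff]
  constructor <;> dsimp only <;> linarith

theorem tendsto_reflect_gridFilter (z K : ℝ) :
    Tendsto (fun p : ℝ × ℝ × ℝ => (p.1, -(p.2.1 + p.1), p.2.2)) (gridFilter z K)
      (gridFilter (-z) (K + 1)) := by
  intro s hs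
  obtain ⟨h₀, h0, H⟩ := eventually_gridFilter.mp (show ∀ᶠ p in _, p ∈ s from hs)
  refine eventually_gridFilter.mpr ⟨h₀, h0, fun h x ε h1 h2 h3 h4 => H _ _ _ h1 h2 ?_ h4⟩
  have := abs_sub_le_iff.mp h3
  rw [abs_sub_le_iff]
  constructor <;> dsimp only <;> linarith

theorem abs_add_mul_sub_le {z K R h x ξ : ℝ} (hh : 0 < h) (hx : |x - z| ≤ K * h) (hξ : |ξ| ≤ R) :
    |x + h * ξ - z| ≤ (K + R) * h := by
  have h1 : |h * ξ| ≤ R * h := by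
    rw [abs_mul, abs_of_pos hh, mul_comm]
    exact mul_le_mul_of_nonneg_right hξ hh.le
  calc |x + h * ξ - z| = |(x - z) + h * ξ| := by ring_nf
    _ ≤ |x - z| + |h * ξ| := abs_add_le _ _
    _ ≤ (K + R) * h := by linarith

theorem eventually_forall_gridFilter {z : ℝ} {P : ℝ → Prop} (hP : ∀ᶠ y in 𝓝 z, P y) (K R : ℝ) :
    ∀ᶠ p in gridFilter z K, ∀ ξ : ℝ, |ξ| ≤ R → P (p.2.1 + p.1 * ξ) := by
  obtain ⟨δ, hδ, H⟩ := Metric.eventually_nhds_iff.mp hP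
  have h1 : Tendsto (fun p : ℝ × ℝ × ℝ => (K + R) * p.1) (gridFilter z K) (𝓝 0) := by
    simpa using (tendsto_fst_gridFilter z K).const_mul (K + R)
  filter_upwards [eventually_mem_gridFilter z K, h1.eventually (gt_mem_nhds hδ)] with p hp hp' ξ hξ
  refine H ?_
  rw [Real.dist_eq]
  exact (abs_add_mul_sub_le hp.1 hp.2.2.1 hξ).trans_lt hp'

/-! ### Taylor polynomials -/

/-- The Taylor polynomial of `u` at `z` of degree `< N`, in the variable `y - z`. -/
def taylorPoly (u : ℝ → ℝ) (z : ℝ) (N : ℕ) : ℝ[X] :=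
  ∑ k ∈ range N, monomial k (iteratedDeriv k u z / k.factorial)

theorem coeff_taylorPoly (u : ℝ → ℝ) (z : ℝ) (N k : ℕ) :
    (taylorPoly u z N).coeff k = if k < N then iteratedDeriv k u z / k.factorial else 0 := by
  rw [taylorPoly, finsetSum_coeff]
  simp only [coeff_monomial, sum_ite_eq', mem_range]

theorem degree_taylorPoly_lt (u : ℝ → ℝ) (z : ℝ) (N : ℕ) : (taylorPoly u z N).degree < N := by
  rw [degree_lt_iff_coeff_zero]
  intro k hk
  rw [coeff_taylorPoly, if_neg (not_lt.mpr hk)]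

theorem taylorPoly_isBigO {u : ℝ → ℝ} {z : ℝ} (hu : ContDiffAt ℝ ∞ u z) (N : ℕ) :
    (fun y => u y - (taylorPoly u z N).eval (y - z)) =O[𝓝 z] fun y => (y - z) ^ N := by
  obtain ⟨s, hs, hus⟩ := (hu.of_le (m := N) (by exact_mod_cast le_top)).contDiffOn le_rfl (by simp)
  obtain ⟨δ, hδ, hball⟩ := Metric.mem_nhds_iff.mp (by simpa using hs : s ∈ 𝓝 z)
  have hz : z ∈ Metric.ball z δ := Metric.mem_ball_self hδ
  have h := (taylor_isLittleO (convex_ball z δ) hz (hus.mono hball)).isBigO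
  rw [Metric.isOpen_ball.nhdsWithin_eq hz] at h
  -- Taylor's formula is available with the term of degree `N` included; that term is itself of the
  -- size of the error and is moved into it.
  have h2 : (fun y : ℝ => iteratedDeriv N u z / N.factorial * (y - z) ^ N) =O[𝓝 z]
      fun y => (y - z) ^ N := (isBigO_refl _ _).const_mul_left _
  refine (h.add h2).congr_left fun y => ?_
  rw [taylor_within_apply, sum_range_succ, taylorPoly, eval_finsetSum]
  simp only [iteratedDerivWithin_of_isOpen Metric.isOpen_ball hz, eval_monomial, smul_eq_mul]
  have e : ∀ k : ℕ, (k.factorial : ℝ)⁻¹ * (y - z) ^ k * iteratedDeriv k u z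
      = iteratedDeriv k u z / k.factorial * (y - z) ^ k := fun k => by ring
  simp only [e]
  ring

/-- The polynomial `ξ ↦ T (a + h ξ)`. -/
def scaledPoly (T : ℝ[X]) (a h : ℝ) : ℝ[X] :=
  (taylor a T).comp (C h * X)

theorem eval_scaledPoly (T : ℝ[X]) (a h ξ : ℝ) :
    (scaledPoly T a h).eval ξ = T.eval (a + h * ξ) := by
  simp [scaledPoly, taylor_apply, add_comm]

theorem coeff_scaledPoly (T : ℝ[X]) (a h : ℝ) (k : ℕ) :
    (scaledPoly T a h).coeff k = (taylor a T).coeff k * h ^ k := by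
  rw [scaledPoly, comp_C_mul_X_coeff]

theorem degree_scaledPoly_lt {T : ℝ[X]} {m : ℕ} (hT : T.degree < m) (a h : ℝ) :
    (scaledPoly T a h).degree < m := by
  rw [degree_lt_iff_coeff_zero]
  intro k hk
  rw [coeff_scaledPoly, coeff_eq_zero_of_degree_lt, zero_mul]
  rw [degree_taylor]
  exact hT.trans_le (by exact_mod_cast hk)

/-- Recentring leaves the top coefficient unchanged. This makes the leading error constant of the
reconstruction independent of the cell. -/
theorem coeff_scaledPoly_top {T : ℝ[X]} {m : ℕ} (hT : T.degree < (m + 1 : ℕ)) (a h : ℝ) :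
    (scaledPoly T a h).coeff m = T.coeff m * h ^ m := by
  rw [coeff_scaledPoly, taylor_coeff]
  congr 1
  have : hasseDeriv m T = C (T.coeff m) := by
    ext k
    rw [hasseDeriv_coeff, coeff_C]
    split_ifs with hk
    · simp [hk]
    · rw [coeff_eq_zero_of_degree_lt, mul_zero]
      exact hT.trans_le (by exact_mod_cast (by omega : m + 1 ≤ k + m))
  rw [this, eval_C]

theorem iterate_derivative_scaledPoly (T : ℝ[X]) (a h : ℝ) (l : ℕ) :
    derivative^[l] (scaledPoly T a h) = C (h ^ l) * scaledPoly (derivative^[l] T) a h := by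
  induction l generalizing T with
  | zero => simp
  | succ l ih =>
    have h1 : derivative (scaledPoly T a h) = C h * scaledPoly (derivative T) a h := by
      simp [scaledPoly, taylor_apply, derivative_comp]
    rw [Function.iterate_succ_apply, h1, iterate_derivative_C_mul, ih, Function.iterate_succ_apply,
      pow_succ', C_mul, mul_assoc]

/-! ### Cell averages of a smooth function -/

theorem averages_eq_integral (u : ℝ → ℝ) {h : ℝ} (hh : h ≠ 0) (x : ℝ) (i : ℤ) :
    averages u h x i = ∫ ξ in ((i : ℝ) - 1 / 2)..(i + 1 / 2), u (x + h * ξ) := by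
  rw [intervalIntegral.integral_comp_add_mul _ hh, averages, cellAverage, smul_eq_mul, one_div]
  congr 2 <;> ring

theorem averages_sub_polyAverages_isBigO {u : ℝ → ℝ} {z : ℝ} (hu : ContDiffAt ℝ ∞ u z) (K : ℝ)
    (N : ℕ) (i : ℤ) :
    (fun p : ℝ × ℝ × ℝ => averages u p.1 p.2.1 i
      - polyAverages (scaledPoly (taylorPoly u z N) (p.2.1 - z) p.1) i)
      =O[gridFilter z K] fun p => p.1 ^ N := by
  obtain ⟨C, hC, hT⟩ := (taylorPoly_isBigO hu N).exists_nonneg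
  rw [isBigOWith_iff] at hT
  have hcont : ∀ᶠ y in 𝓝 z, ContinuousAt u y :=
    ((hu.of_le (m := 1) (by exact_mod_cast le_top)).eventually (by simp)).mono
      fun y hy => hy.continuousAt
  set R : ℝ := |(i : ℝ)| + 1 / 2 with hR
  refine .of_bound (C * (K + R) ^ N) ?_
  filter_upwards [eventually_mem_gridFilter z K, eventually_forall_gridFilter hT K R,
    eventually_forall_gridFilter hcont K R] with p hp hT hcont
  have hh := hp.1
  have hξR : ∀ ξ ∈ Set.uIcc ((i : ℝ) - 1 / 2) (i + 1 / 2), |ξ| ≤ R := by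
    intro ξ hξ
    rw [Set.uIcc_of_le (by linarith)] at hξ
    have h1 : |ξ - i| ≤ 1 / 2 := abs_sub_le_iff.mpr ⟨by linarith [hξ.2], by linarith [hξ.1]⟩
    calc |ξ| = |i + (ξ - i)| := by ring_nf
      _ ≤ R := (abs_add_le _ _).trans (by linarith)
  have hint : IntervalIntegrable (fun ξ : ℝ => u (p.2.1 + p.1 * ξ)) MeasureTheory.volume
      ((i : ℝ) - 1 / 2) (i + 1 / 2) := by
    refine ContinuousOn.intervalIntegrable fun ξ hξ => ContinuousAt.continuousWithinAt ?_
    exact ContinuousAt.comp (f := fun ξ : ℝ => p.2.1 + p.1 * ξ) (hcont ξ (hξR ξ hξ)) (by fun_prop)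
  rw [averages_eq_integral u hh.ne', polyAverages, ← intervalIntegral.integral_sub hint
    ((Polynomial.continuous _).intervalIntegrable _ _)]
  have := intervalIntegral.norm_integral_le_of_norm_le_const (a := (i : ℝ) - 1 / 2)
    (b := i + 1 / 2) (C := C * (K + R) ^ N * ‖p.1 ^ N‖)
    (f := fun ξ => u (p.2.1 + p.1 * ξ)
      - (scaledPoly (taylorPoly u z N) (p.2.1 - z) p.1).eval ξ) fun ξ hξ => ?_
  · refine this.trans (le_of_eq ?_)
    rw [show (i : ℝ) + 1 / 2 - (i - 1 / 2) = 1 by ring, abs_one, mul_one]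
  · have hξ' := hξR ξ (Set.uIoc_subset_uIcc hξ)
    rw [eval_scaledPoly, show p.2.1 - z + p.1 * ξ = p.2.1 + p.1 * ξ - z by ring]
    refine (hT ξ hξ').trans ?_
    rw [mul_assoc, norm_pow, norm_pow, ← mul_pow]
    refine mul_le_mul_of_nonneg_left (pow_le_pow_left₀ (norm_nonneg _) ?_ _) hC
    rw [Real.norm_eq_abs, Real.norm_eq_abs, abs_of_pos hh]
    exact abs_add_mul_sub_le hh hp.2.2.1 hξ'

/-- The reconstructions from the averages of a function and of its Taylor polynomial differ by
`O(h ^ N)`, together with their derivatives. -/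
theorem exists_abs_eval_reconPoly_averages_sub_le {u : ℝ → ℝ} {z : ℝ} (hu : ContDiffAt ℝ ∞ u z)
    (K : ℝ) (N : ℕ) (a : ℤ) (m l : ℕ) :
    ∃ C : ℝ, ∀ᶠ p in gridFilter z K, ∀ ξ ∈ Set.Icc (-(1 / 2) : ℝ) (1 / 2),
      |(derivative^[l] (reconPoly (averages u p.1 p.2.1) a m)).eval ξ
        - (derivative^[l] (reconPoly (polyAverages
          (scaledPoly (taylorPoly u z N) (p.2.1 - z) p.1)) a m)).eval ξ| ≤ C * p.1 ^ N := by
  obtain ⟨C, hC⟩ := exists_abs_eval_reconPoly_le a m l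
  choose D hD using fun i : ℕ => (averages_sub_polyAverages_isBigO hu K N (a + i)).bound
  refine ⟨C * ∑ i ∈ range m, |D i|, ?_⟩
  have hD' : ∀ᶠ p in gridFilter z K, ∀ i ∈ range m, _ :=
    (eventually_all_finset _).mpr fun i _ => hD i
  filter_upwards [hD', eventually_mem_gridFilter z K] with p hp hp' ξ hξ
  rw [← eval_sub, ← iterate_derivative_sub, ← reconPoly_sub, mul_assoc]
  refine hC _ _ (fun i hi => ?_) ξ hξ
  refine (hp i (mem_range.mpr hi)).trans ?_
  rw [Real.norm_eq_abs, abs_of_pos (pow_pos hp'.1 N)]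
  refine mul_le_mul_of_nonneg_right ((le_abs_self _).trans ?_) (pow_pos hp'.1 N).le
  exact single_le_sum (f := fun i => |D i|) (fun i _ => abs_nonneg _) (mem_range.mpr hi)

/-- The reconstruction on `m` cells at the right edge of a cell is of order `m`, with a leading
error term that does not depend on the cell. -/
theorem exists_eval_reconPoly_sub_isBigO {u : ℝ → ℝ} {z : ℝ} (hu : ContDiffAt ℝ ∞ u z) (a : ℤ)
    (m : ℕ) :
    ∃ e : ℝ, ∀ K : ℝ, (fun p : ℝ × ℝ × ℝ => (reconPoly (averages u p.1 p.2.1) a m).eval (1 / 2)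
      - (u (p.2.1 + p.1 * (1 / 2)) + e * p.1 ^ m)) =O[gridFilter z K] fun p => p.1 ^ (m + 1) := by
  set T := taylorPoly u z (m + 1) with hT
  set Q := reconPoly (polyAverages (X ^ m)) a m with hQ
  -- The reconstruction is exact below degree `m`, so the leading error is the top Taylor
  -- coefficient times the error made on the monomial `ξ^m`.
  refine ⟨T.coeff m * (Q.eval (1 / 2) - (1 / 2) ^ m), fun K => ?_⟩
  obtain ⟨C₁, h1⟩ := exists_abs_eval_reconPoly_averages_sub_le hu K (m + 1) a m 0
  have h1' : (fun p : ℝ × ℝ × ℝ => (reconPoly (averages u p.1 p.2.1) a m).eval (1 / 2)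
      - (reconPoly (polyAverages (scaledPoly T (p.2.1 - z) p.1)) a m).eval (1 / 2))
      =O[gridFilter z K] fun p => p.1 ^ (m + 1) := by
    refine .of_bound C₁ ?_
    filter_upwards [h1, eventually_mem_gridFilter z K] with p hp hp'
    rw [Real.norm_eq_abs, Real.norm_eq_abs, abs_of_pos (pow_pos hp'.1 _)]
    exact hp (1 / 2) ⟨by norm_num, le_rfl⟩
  obtain ⟨C₂, hC₂, h2⟩ := (taylorPoly_isBigO hu (m + 1)).exists_nonneg
  rw [isBigOWith_iff] at h2
  have h2' : (fun p : ℝ × ℝ × ℝ => u (p.2.1 + p.1 * (1 / 2))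
      - T.eval (p.2.1 + p.1 * (1 / 2) - z)) =O[gridFilter z K] fun p => p.1 ^ (m + 1) := by
    refine .of_bound (C₂ * (K + 1 / 2) ^ (m + 1)) ?_
    filter_upwards [eventually_forall_gridFilter h2 K (1 / 2),
      eventually_mem_gridFilter z K] with p hp hp'
    have hhalf : |(1 / 2 : ℝ)| ≤ 1 / 2 := by rw [abs_of_pos (by norm_num)]
    refine (hp (1 / 2) hhalf).trans ?_
    rw [mul_assoc, norm_pow, norm_pow, ← mul_pow]
    refine mul_le_mul_of_nonneg_left (pow_le_pow_left₀ (norm_nonneg _) ?_ _) hC₂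
    rw [Real.norm_eq_abs, Real.norm_eq_abs, abs_of_pos hp'.1]
    exact abs_add_mul_sub_le hp'.1 hp'.2.2.1 hhalf
  refine (h1'.sub h2').congr_left fun p => ?_
  set q := scaledPoly T (p.2.1 - z) p.1 with hq
  have hTd : T.degree < (m + 1 : ℕ) := degree_taylorPoly_lt u z (m + 1)
  have hqd : q.degree < (m + 1 : ℕ) := degree_scaledPoly_lt hTd _ _
  have hlow : (q - C (q.coeff m) * X ^ m).degree < (m : WithBot ℕ) := by
    rw [degree_lt_iff_coeff_zero]
    intro k hk
    rw [coeff_sub, coeff_C_mul, coeff_X_pow]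
    split_ifs with hkm
    · rw [hkm, mul_one, sub_self]
    · rw [mul_zero, sub_zero]
      exact coeff_eq_zero_of_degree_lt (hqd.trans_le (by exact_mod_cast (by omega : m + 1 ≤ k)))
  have hrec : reconPoly (polyAverages q) a m
      = q - C (q.coeff m) * X ^ m + C (q.coeff m) * Q := by
    have h3 := reconPoly_polyAverages _ a m hlow
    have h4 : polyAverages (q - C (q.coeff m) * X ^ m)
        = fun i => polyAverages q i - q.coeff m * polyAverages (X ^ m) i := by
      ext i
      rw [polyAverages_sub, polyAverages_C_mul]
    rw [h4, reconPoly_sub, reconPoly_const_mul] at h3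
    rw [← h3, hQ, sub_add_cancel]
  rw [hrec, coeff_scaledPoly_top hTd]
  simp only [eval_add, eval_sub, eval_mul, eval_C, eval_pow, eval_X]
  rw [hq, eval_scaledPoly, show p.2.1 - z + p.1 * (1 / 2) = p.2.1 + p.1 * (1 / 2) - z by ring]
  ring

theorem subValue_sub_isBigO {u : ℝ → ℝ} {z : ℝ} (hu : ContDiffAt ℝ ∞ u z) (K : ℝ) (r s : ℕ) :
    (fun p : ℝ × ℝ × ℝ => subValue r (averages u p.1 p.2.1) s - u (p.2.1 + p.1 * (1 / 2)))
      =O[gridFilter z K] fun p => p.1 ^ r := by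
  obtain ⟨e, he⟩ := exists_eval_reconPoly_sub_isBigO hu ((s : ℤ) - r + 1) r
  have h1 := (he K).trans (isBigO_pow_gridFilter z K (Nat.le_succ r))
  have h2 : (fun p : ℝ × ℝ × ℝ => e * p.1 ^ r) =O[gridFilter z K] fun p => p.1 ^ r :=
    (isBigO_refl _ _).const_mul_left e
  refine (h1.add h2).congr_left fun p => ?_
  rw [subValue, subPoly]
  ring

/-! ### Smoothness indicators near a critical point -/

theorem abs_le_half_of_mem {ξ : ℝ} (hξ : ξ ∈ Set.Icc (-(1 / 2) : ℝ) (1 / 2)) : |ξ| ≤ 1 / 2 :=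
  abs_le.mpr hξ

/-- `T - T(0)` is divisible by `X^(m+1)`, so its derivative of order `l` has a zero of order at
least `m + 1 - l` at `0`. Scaling contributes the remaining factor `h^l`. -/
theorem exists_abs_iterate_derivative_scaledPoly_le {u : ℝ → ℝ} {z : ℝ} {m : ℕ}
    (hz : IsCriticalOfOrder u z m) (r : ℕ) (K : ℝ) {l : ℕ} (hl : 1 ≤ l) :
    ∃ C : ℝ, 0 ≤ C ∧ ∀ᶠ p in gridFilter z K, ∀ ξ ∈ Set.Icc (-(1 / 2) : ℝ) (1 / 2),
      |(derivative^[l] (scaledPoly (taylorPoly u z r) (p.2.1 - z) p.1)).eval ξ|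
        ≤ C * p.1 ^ (m + 1) := by
  set T := taylorPoly u z r with hT
  have hdvd : X ^ (m + 1) ∣ T - C (T.coeff 0) := by
    rw [X_pow_dvd_iff]
    intro k hk
    rw [coeff_sub, coeff_C]
    split_ifs with h0
    · rw [h0, sub_self]
    · rw [hT, coeff_taylorPoly, hz.1 k (by omega) (by omega)]
      simp
  have hder : derivative^[l] T = derivative^[l] (T - C (T.coeff 0)) := by
    rw [iterate_derivative_sub, iterate_derivative_C hl, sub_zero]
  obtain ⟨S, hS⟩ := pow_sub_dvd_iterate_derivative_of_pow_dvd l hdvd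
  rw [← hder] at hS
  obtain ⟨M, hM⟩ := isCompact_Icc.exists_bound_of_continuousOn
    (s := Set.Icc (-1 : ℝ) 1) (Polynomial.continuous S).continuousOn
  have hM0 : 0 ≤ M := (norm_nonneg _).trans (hM 0 (by simp))
  refine ⟨|K + 1 / 2| ^ (m + 1 - l) * M, by positivity, ?_⟩
  have hnear : ∀ᶠ y in 𝓝 z, |y - z| ≤ 1 :=
    (Metric.closedBall_mem_nhds z one_pos : ∀ᶠ y in 𝓝 z, dist y z ≤ 1)
  filter_upwards [eventually_mem_gridFilter z K,
    eventually_forall_gridFilter hnear K (1 / 2)] with p hp hp1 ξ hξ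
  have hξ' := abs_le_half_of_mem hξ
  have hy := abs_add_mul_sub_le hp.1 hp.2.2.1 hξ'
  rw [iterate_derivative_scaledPoly, eval_mul, eval_C, eval_scaledPoly, hS, eval_mul, eval_pow,
    eval_X, show p.2.1 - z + p.1 * ξ = p.2.1 + p.1 * ξ - z by ring, abs_mul, abs_mul, abs_pow,
    abs_pow, abs_of_pos hp.1]
  have h1 : |p.2.1 + p.1 * ξ - z| ^ (m + 1 - l) ≤ (|K + 1 / 2| * p.1) ^ (m + 1 - l) :=
    pow_le_pow_left₀ (abs_nonneg _)
      (hy.trans (mul_le_mul_of_nonneg_right (le_abs_self _) hp.1.le)) _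
  have h2 : |S.eval (p.2.1 + p.1 * ξ - z)| ≤ M := hM _ (abs_le.mp (hp1 ξ hξ'))
  -- For `l > m + 1` the subtraction truncates to `0`, and `h < 1` gives the bound.
  have h3 : p.1 ^ (l + (m + 1 - l)) ≤ p.1 ^ (m + 1) :=
    pow_le_pow_of_le_one hp.1.le hp.2.1.le (by omega)
  have := hp.1
  calc p.1 ^ l * (|p.2.1 + p.1 * ξ - z| ^ (m + 1 - l) * |S.eval (p.2.1 + p.1 * ξ - z)|)
      ≤ p.1 ^ l * ((|K + 1 / 2| * p.1) ^ (m + 1 - l) * M) := by gcongr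
    _ = |K + 1 / 2| ^ (m + 1 - l) * M * p.1 ^ (l + (m + 1 - l)) := by rw [mul_pow, pow_add]; ring
    _ ≤ |K + 1 / 2| ^ (m + 1 - l) * M * p.1 ^ (m + 1) := by gcongr

/-- The derivative of order `m + 1` of `T` at `0` is `u^{(m+1)}(z) ≠ 0`, and continuity keeps half
of its size nearby. The hypothesis `m + 1 < r` keeps this coefficient in `T`. -/
theorem exists_le_abs_iterate_derivative_scaledPoly {u : ℝ → ℝ} {z : ℝ} {m : ℕ}
    (hz : IsCriticalOfOrder u z m) {r : ℕ} (hm : m + 1 < r) (K : ℝ) :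
    ∃ c > 0, ∀ᶠ p in gridFilter z K, ∀ ξ ∈ Set.Icc (-(1 / 2) : ℝ) (1 / 2),
      c * p.1 ^ (m + 1)
        ≤ |(derivative^[m + 1] (scaledPoly (taylorPoly u z r) (p.2.1 - z) p.1)).eval ξ| := by
  set T := taylorPoly u z r with hT
  have h0 : (derivative^[m + 1] T).eval 0 ≠ 0 := by
    rw [← coeff_zero_eq_eval_zero, coeff_iterate_derivative, hT, coeff_taylorPoly, zero_add,
      if_pos hm, nsmul_eq_mul, Nat.descFactorial_self]
    have := Nat.factorial_ne_zero (m + 1)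
    exact mul_ne_zero (by exact_mod_cast this) (div_ne_zero hz.2 (by exact_mod_cast this))
  set c := |(derivative^[m + 1] T).eval 0| with hc
  have hc0 : 0 < c := abs_pos.mpr h0
  have hev : ∀ᶠ y in 𝓝 z, c / 2 < |(derivative^[m + 1] T).eval (y - z)| := by
    have hcont : ContinuousAt (fun y => |(derivative^[m + 1] T).eval (y - z)|) z := by fun_prop
    have := hcont.tendsto
    simp only [sub_self] at this
    exact this.eventually (lt_mem_nhds (half_lt_self hc0))
  refine ⟨c / 2, half_pos hc0, ?_⟩
  filter_upwards [eventually_mem_gridFilter z K,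
    eventually_forall_gridFilter hev K (1 / 2)] with p hp hp1 ξ hξ
  rw [iterate_derivative_scaledPoly, eval_mul, eval_C, eval_scaledPoly, abs_mul, abs_pow,
    abs_of_pos hp.1, show p.2.1 - z + p.1 * ξ = p.2.1 + p.1 * ξ - z by ring, mul_comm]
  exact mul_le_mul_of_nonneg_left (hp1 ξ (abs_le_half_of_mem hξ)).le (pow_pos hp.1 _).le

/-- The quadratic functional of which the smoothness indicators are values. -/
def polyIndicator (r : ℕ) (q : ℝ[X]) : ℝ :=
  ∑ l ∈ Icc 1 (r - 1), ∫ ξ in (-(1 / 2 : ℝ))..(1 / 2), ((derivative^[l] q).eval ξ) ^ 2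

theorem smoothnessIndicator_eq (r : ℕ) (v : ℤ → ℝ) (s : ℕ) :
    smoothnessIndicator r v s = polyIndicator r (subPoly r v s) := rfl

theorem integral_sq_nonneg (q : ℝ[X]) : 0 ≤ ∫ ξ in (-(1 / 2 : ℝ))..(1 / 2), (q.eval ξ) ^ 2 :=
  intervalIntegral.integral_nonneg (by norm_num) fun _ _ => sq_nonneg _

theorem smoothnessIndicator_nonneg (r : ℕ) (v : ℤ → ℝ) (s : ℕ) :
    0 ≤ smoothnessIndicator r v s :=
  sum_nonneg fun _ _ => integral_sq_nonneg _

theorem abs_integral_sq_sub_le {p q : ℝ[X]} {A D : ℝ}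
    (hq : ∀ ξ ∈ Set.Icc (-(1 / 2) : ℝ) (1 / 2), |q.eval ξ| ≤ A)
    (hpq : ∀ ξ ∈ Set.Icc (-(1 / 2) : ℝ) (1 / 2), |p.eval ξ - q.eval ξ| ≤ D) :
    |(∫ ξ in (-(1 / 2 : ℝ))..(1 / 2), (p.eval ξ) ^ 2)
      - ∫ ξ in (-(1 / 2 : ℝ))..(1 / 2), (q.eval ξ) ^ 2| ≤ D * (2 * A + D) := by
  rw [← intervalIntegral.integral_sub (Continuous.intervalIntegrable (by fun_prop) _ _)
    (Continuous.intervalIntegrable (by fun_prop) _ _)]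
  have := intervalIntegral.norm_integral_le_of_norm_le_const (a := -(1 / 2 : ℝ))
    (b := 1 / 2) (C := D * (2 * A + D)) (f := fun ξ => (p.eval ξ) ^ 2 - (q.eval ξ) ^ 2)
    fun ξ hξ => ?_
  · refine this.trans (le_of_eq ?_)
    norm_num
  · rw [Set.uIoc_of_le (by norm_num)] at hξ
    have h1 := hq ξ ⟨hξ.1.le, hξ.2⟩
    have h2 := hpq ξ ⟨hξ.1.le, hξ.2⟩
    rw [Real.norm_eq_abs, show (p.eval ξ) ^ 2 - (q.eval ξ) ^ 2
      = (p.eval ξ - q.eval ξ) * (2 * q.eval ξ + (p.eval ξ - q.eval ξ)) by ring, abs_mul]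
    refine mul_le_mul h2 ((abs_add_le _ _).trans ?_) (abs_nonneg _) ((abs_nonneg _).trans h2)
    rw [abs_mul, abs_two]
    linarith

/-- Near a critical point of order `m < r - 1` the smoothness indicators of all substencils agree
up to a relative error `O(h ^ (r - 1 - m))`. -/
theorem exists_smoothnessIndicator_sub_isBigO {u : ℝ → ℝ} {z : ℝ} (hu : ContDiffAt ℝ ∞ u z)
    {m : ℕ} (hz : IsCriticalOfOrder u z m) {r : ℕ} (hm : m + 1 < r) (K : ℝ) :
    ∃ B : ℝ × ℝ × ℝ → ℝ, (∀ᶠ p in gridFilter z K, 0 < B p) ∧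
      ∀ s, (fun p : ℝ × ℝ × ℝ => (smoothnessIndicator r (averages u p.1 p.2.1) s - B p) / B p)
        =O[gridFilter z K] fun p => p.1 ^ (r - 1 - m) := by
  set q : ℝ × ℝ × ℝ → ℝ[X] := fun p => scaledPoly (taylorPoly u z r) (p.2.1 - z) p.1 with hqdef
  obtain ⟨c, hc, hlow⟩ := exists_le_abs_iterate_derivative_scaledPoly hz hm K
  have hB : ∀ᶠ p in gridFilter z K, c ^ 2 * p.1 ^ (2 * (m + 1)) ≤ polyIndicator r (q p) := by
    filter_upwards [hlow, eventually_mem_gridFilter z K] with p hp hp'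
    -- All terms are nonnegative; only `l = m + 1` is kept, which lies in the range of summation
    -- because `m + 1 < r`.
    refine le_trans ?_ (single_le_sum
      (f := fun l => ∫ ξ in (-(1 / 2 : ℝ))..(1 / 2), ((derivative^[l] (q p)).eval ξ) ^ 2)
      (fun l _ => integral_sq_nonneg _) (mem_Icc.mpr ⟨by omega, by omega⟩ : m + 1 ∈ _))
    have h1 : ∫ ξ in (-(1 / 2 : ℝ))..(1 / 2), c ^ 2 * p.1 ^ (2 * (m + 1))
        = c ^ 2 * p.1 ^ (2 * (m + 1)) := by
      rw [intervalIntegral.integral_const, smul_eq_mul]; norm_num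
    rw [← h1]
    refine intervalIntegral.integral_mono_on (by norm_num) (by simp)
      (Continuous.intervalIntegrable (by fun_prop) _ _) fun ξ hξ => ?_
    rw [mul_comm 2, pow_mul, ← mul_pow, ← sq_abs ((derivative^[m + 1] (q p)).eval ξ)]
    have := pow_pos hp'.1 (m + 1)
    exact pow_le_pow_left₀ (by positivity) (hp ξ hξ) 2
  refine ⟨fun p => polyIndicator r (q p), ?_, fun s => ?_⟩
  · filter_upwards [hB, eventually_mem_gridFilter z K] with p hp hp'
    have := pow_pos hp'.1 (2 * (m + 1))
    exact lt_of_lt_of_le (by positivity) hp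
  · have hdiff : (fun p : ℝ × ℝ × ℝ => smoothnessIndicator r (averages u p.1 p.2.1) s
        - polyIndicator r (q p)) =O[gridFilter z K] fun p => p.1 ^ (r + (m + 1)) := by
      simp only [smoothnessIndicator_eq, polyIndicator, ← sum_sub_distrib]
      refine IsBigO.fun_sum fun l hl => ?_
      obtain ⟨A, hA0, hA⟩ := exists_abs_iterate_derivative_scaledPoly_le hz r K (mem_Icc.mp hl).1
      obtain ⟨D, hD⟩ := exists_abs_eval_reconPoly_averages_sub_le hu K r ((s : ℤ) - r + 1) r l
      refine .of_bound (|D| * (2 * A + |D|)) ?_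
      filter_upwards [hA, hD, eventually_mem_gridFilter z K] with p hA hD hp
      have hr := pow_pos hp.1 r
      have hD' : ∀ ξ ∈ Set.Icc (-(1 / 2) : ℝ) (1 / 2),
          |(derivative^[l] (subPoly r (averages u p.1 p.2.1) s)).eval ξ
            - (derivative^[l] (q p)).eval ξ| ≤ |D| * p.1 ^ r := by
        intro ξ hξ
        have := hD ξ hξ
        -- Exactness in degree `< r`: whatever the substencil, the comparison polynomial is `q`
        -- itself.
        rw [reconPoly_polyAverages _ _ _ (degree_scaledPoly_lt (degree_taylorPoly_lt u z r) _ _)]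
          at this
        exact this.trans (mul_le_mul_of_nonneg_right (le_abs_self _) hr.le)
      have hpow : p.1 ^ r ≤ p.1 ^ (m + 1) := pow_le_pow_of_le_one hp.1.le hp.2.1.le hm.le
      rw [Real.norm_eq_abs, Real.norm_eq_abs, abs_of_pos (pow_pos hp.1 _)]
      calc _ ≤ |D| * p.1 ^ r * (2 * (A * p.1 ^ (m + 1)) + |D| * p.1 ^ r) :=
            abs_integral_sq_sub_le hA hD'
        _ ≤ |D| * p.1 ^ r * (2 * (A * p.1 ^ (m + 1)) + |D| * p.1 ^ (m + 1)) := by gcongr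
        _ = _ := by ring
    obtain ⟨C, hC, hd⟩ := hdiff.exists_nonneg
    refine .of_bound (C / c ^ 2) ?_
    filter_upwards [hd.bound, hB, eventually_mem_gridFilter z K] with p hd hB hp
    have h2 := pow_pos hp.1 (2 * (m + 1))
    have hBp : 0 < polyIndicator r (q p) := lt_of_lt_of_le (by positivity) hB
    rw [norm_div, Real.norm_eq_abs (polyIndicator r (q p)), abs_of_pos hBp, div_le_iff₀ hBp]
    refine hd.trans ?_
    rw [Real.norm_eq_abs, Real.norm_eq_abs, abs_of_pos (pow_pos hp.1 _), abs_of_pos (pow_pos hp.1 _)]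
    have h3 := pow_pos hp.1 (r - 1 - m)
    calc C * p.1 ^ (r + (m + 1)) = C / c ^ 2 * p.1 ^ (r - 1 - m) * (c ^ 2 * p.1 ^ (2 * (m + 1))) := by
          rw [show r + (m + 1) = (r - 1 - m) + 2 * (m + 1) by omega, pow_add]
          field_simp
      _ ≤ _ := by gcongr

/-! ### Ideal weights and normalization -/

theorem idealWeight_pos {r s : ℕ} (hs : s < r) : 0 < idealWeight r s := by
  have h1 : 0 < r.choose s := Nat.choose_pos hs.le
  have h2 : 0 < (r - 1).choose s := Nat.choose_pos (by omega)
  have h3 : 0 < (2 * r - 1).choose r := Nat.choose_pos (by omega)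
  rw [idealWeight]
  positivity

/-- Every reconstruction reproduces the constant `1`, so the defining identity of the weights,
applied to it, gives their sum. -/
theorem sum_idealWeight {r : ℕ} (hr : 1 ≤ r) : ∑ s ∈ range r, idealWeight r s = 1 := by
  have h := sum_idealWeight_mul_subValue r hr (polyAverages 1)
  have h1 : ∀ (m : ℕ) (a : ℤ), 1 ≤ m → (reconPoly (polyAverages 1) a m).eval (1 / 2) = 1 := by
    intro m a hm
    rw [reconPoly_polyAverages, eval_one]
    rw [degree_one]
    exact_mod_cast hm
  simpa only [subValue, subPoly, h1 r _ hr, h1 (2 * r - 1) _ (by omega), mul_one] using h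

theorem idealWeight_lt_one {r s : ℕ} (hr : 2 ≤ r) (hs : s < r) : idealWeight r s < 1 := by
  rw [← sum_idealWeight (by omega : 1 ≤ r)]
  obtain ⟨t, ht, hts⟩ : ∃ t < r, t ≠ s :=
    if h : s = 0 then ⟨1, by omega, by omega⟩ else ⟨0, by omega, by omega⟩
  exact single_lt_sum hts (mem_range.mpr hs) (mem_range.mpr ht) (idealWeight_pos ht)
    fun k hk _ => (idealWeight_pos (mem_range.mp hk)).le

/-- Positive weights with sum `1`. -/
def IsWeightVector (r : ℕ) (w : ℕ → ℝ) : Prop :=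
  (∀ s < r, 0 < w s) ∧ ∑ s ∈ range r, w s = 1

theorem IsWeightVector.le_one {r : ℕ} {w : ℕ → ℝ} (hw : IsWeightVector r w) {s : ℕ} (hs : s < r) :
    w s ≤ 1 :=
  hw.2 ▸ single_le_sum (fun k hk => (hw.1 k (mem_range.mp hk)).le) (mem_range.mpr hs)

theorem isWeightVector_normalizeWeights {r : ℕ} (hr : 1 ≤ r) {a : ℕ → ℝ} (ha : ∀ s < r, 0 < a s) :
    IsWeightVector r (normalizeWeights r a) := by
  have hsum : 0 < ∑ l ∈ range r, a l :=
    sum_pos (fun k hk => ha k (mem_range.mp hk)) ⟨0, mem_range.mpr hr⟩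
  refine ⟨fun s hs => div_pos (ha s hs) hsum, ?_⟩
  simp only [normalizeWeights]
  rw [← sum_div, div_self hsum.ne']

theorem normalizeWeights_const_mul (r : ℕ) {c : ℝ} (hc : c ≠ 0) (a : ℕ → ℝ) :
    normalizeWeights r (fun s => c * a s) = normalizeWeights r a := by
  ext s
  rw [normalizeWeights, normalizeWeights, ← mul_sum, mul_div_mul_left _ _ hc]

/-- The sum of the perturbed weights is `1 + O(g)`, so dividing by it costs only another `O(g)`.
This is why both normalization variants have the same order. -/
theorem normalizeWeights_sub_isBigO {β : Type*} {l : Filter β} {r : ℕ} {d : ℕ → ℝ}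
    (hd : ∑ s ∈ range r, d s = 1) {a : β → ℕ → ℝ} {g : β → ℝ} (hg : Tendsto g l (𝓝 0))
    (ha : ∀ s < r, (fun p => a p s - d s) =O[l] g) {s : ℕ} (hs : s < r) :
    (fun p => normalizeWeights r (a p) s - d s) =O[l] g := by
  have hsum : (fun p => ∑ k ∈ range r, a p k - 1) =O[l] g := by
    have := IsBigO.fun_sum (s := range r) fun k hk => ha k (mem_range.mp hk)
    simpa only [sum_sub_distrib, hd] using this
  have hlim : Tendsto (fun p => ∑ k ∈ range r, a p k) l (𝓝 1) :=
    tendsto_sub_nhds_zero_iff.mp (hsum.trans_tendsto hg)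
  have hinv : (fun p => (∑ k ∈ range r, a p k)⁻¹) =O[l] fun _ => (1 : ℝ) :=
    (hlim.inv₀ one_ne_zero).isBigO_one ℝ
  have h := ((ha s hs).sub (hsum.const_mul_left (d s))).mul hinv
  simp only [mul_one] at h
  refine h.congr' ?_ EventuallyEq.rfl
  filter_upwards [hlim.eventually_ne one_ne_zero] with p hp
  rw [normalizeWeights]
  field_simp
  ring

/-! ### The mapping -/

/-- The two factors are `(w - d)² + d(1 - w)` in the numerator and `(w - d)² + w(1 - w)` in the
denominator. -/
theorem mapM_pos {d w : ℝ} (hd : 0 < d) (hd1 : d < 1) (hw : 0 < w) (hw1 : w ≤ 1) :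
    0 < mapM d w := by
  refine div_pos (mul_pos hw ?_) ?_
  · rcases hw1.eq_or_lt with rfl | h
    · nlinarith
    · nlinarith [mul_pos hd (sub_pos.mpr h), sq_nonneg (w - d)]
  · rcases hw1.eq_or_lt with rfl | h
    · nlinarith
    · nlinarith [mul_pos hw (sub_pos.mpr h), sq_nonneg (w - d)]

/-- Denominator minus numerator is `(1 - w)(w - d)² + w(1 - w)(1 - d)`. -/
theorem mapM_le_one {d w : ℝ} (hd1 : d < 1) (hw : 0 < w) (hw1 : w ≤ 1) :
    mapM d w ≤ 1 := by
  refine div_le_one_of_le₀ ?_ ?_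
  · nlinarith [mul_nonneg (sub_nonneg.mpr hw1) (sq_nonneg (w - d)),
      mul_nonneg (mul_nonneg hw.le (sub_nonneg.mpr hw1)) (sub_nonneg.mpr hd1.le)]
  · nlinarith [mul_nonneg hw.le (sub_nonneg.mpr hw1), sq_nonneg (w - d)]

/-- Exactly, `mapM d w - d = (w - d)³ / (d² + (1 - 2d) w)`, and the denominator tends to `d(1 - d) ≠
0`. -/
theorem mapM_sub_isBigO {d : ℝ} (hd : 0 < d) (hd1 : d < 1) :
    (fun w => mapM d w - d) =O[𝓝 d] fun w => (w - d) ^ 3 := by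
  have hlim : Tendsto (fun w : ℝ => d ^ 2 + (1 - 2 * d) * w) (𝓝 d) (𝓝 (d ^ 2 + (1 - 2 * d) * d)) :=
    Continuous.tendsto (by fun_prop) d
  have h0 : d ^ 2 + (1 - 2 * d) * d ≠ 0 := by
    have := mul_pos hd (sub_pos.mpr hd1)
    nlinarith
  have h := (isBigO_refl (fun w : ℝ => (w - d) ^ 3) (𝓝 d)).mul ((hlim.inv₀ h0).isBigO_one ℝ)
  simp only [mul_one] at h
  refine h.congr' ?_ EventuallyEq.rfl
  filter_upwards [hlim.eventually_ne h0] with w hw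
  rw [mapM, ← div_eq_mul_inv, div_sub' hw]
  congr 1
  ring

theorem minDistIndex_spec {r : ℕ} (hr : 1 ≤ r) (d : ℕ → ℝ) (w : ℝ) :
    minDistIndex r d w < r ∧ ∀ i < r, |w - d (minDistIndex r d w)| ≤ |w - d i| := by
  obtain ⟨k, hk, hmin⟩ := exists_min_image (range r) (fun k => |w - d k|) ⟨0, mem_range.mpr hr⟩
  exact Nat.sInf_mem (s := {k : ℕ | k < r ∧ ∀ i < r, |w - d k| ≤ |w - d i|})
    ⟨k, mem_range.mp hk, fun i hi => hmin i (mem_range.mpr hi)⟩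

theorem mopMapM_mem {r : ℕ} (hr : 2 ≤ r) {w : ℝ} (hw : 0 < w ∧ w ≤ 1) :
    0 < mopMapM r w ∧ mopMapM r w ≤ 1 := by
  have hk := (minDistIndex_spec (by omega : 1 ≤ r) (idealWeight r) w).1
  exact ⟨mapM_pos (idealWeight_pos hk) (idealWeight_lt_one hr hk) hw.1 hw.2,
    mapM_le_one (idealWeight_lt_one hr hk) hw.1 hw.2⟩

/-- Close to `d_s`, the nearest ideal weight has the value `d_s`. Its index may differ when ideal
weights coincide, but only the value enters the mapping. -/
theorem mopMapM_sub_isBigO {r s : ℕ} (hr : 2 ≤ r) (hs : s < r) :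
    (fun w => mopMapM r w - idealWeight r s) =O[𝓝 (idealWeight r s)]
      fun w => (w - idealWeight r s) ^ 3 := by
  have hnear : ∀ᶠ w in 𝓝 (idealWeight r s), ∀ k ∈ range r, idealWeight r k ≠ idealWeight r s →
      |w - idealWeight r s| < |w - idealWeight r k| := by
    refine (eventually_all_finset _).mpr fun k _ => ?_
    rw [eventually_imp_distrib_left]
    intro hk
    refine ContinuousAt.eventually_lt (by fun_prop) (by fun_prop) ?_
    rw [sub_self, abs_zero]
    exact abs_pos.mpr (sub_ne_zero.mpr hk.symm)
  refine (mapM_sub_isBigO (idealWeight_pos hs) (idealWeight_lt_one hr hs)).congr' ?_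
    EventuallyEq.rfl
  filter_upwards [hnear] with w hw
  obtain ⟨hk, hmin⟩ := minDistIndex_spec (by omega : 1 ≤ r) (idealWeight r) w
  have : idealWeight r (minDistIndex r (idealWeight r) w) = idealWeight r s := by
    by_contra hne
    exact absurd (hmin s hs) (not_le.mpr (hw _ (mem_range.mpr hk) hne))
  rw [mopMapM, minDist, this]

/-! ### The nonlinear weights -/

theorem isWeightVector_jsWeight {r : ℕ} (hr : 1 ≤ r) {ε : ℝ} (hε : 0 < ε) (v : ℤ → ℝ) :
    IsWeightVector r (jsWeight r ε v) := by
  refine isWeightVector_normalizeWeights hr fun s hs => div_pos (idealWeight_pos hs) ?_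
  have := smoothnessIndicator_nonneg r v s
  positivity

theorem isWeightVector_mopWeightRenorm {r : ℕ} (hr : 2 ≤ r) (n : ℕ) {ε : ℝ} (hε : 0 < ε)
    (v : ℤ → ℝ) : IsWeightVector r (mopWeightRenorm r n ε v) := by
  induction n with
  | zero => exact isWeightVector_jsWeight (by omega) hε v
  | succ n ih =>
    rw [mopWeightRenorm, Function.iterate_succ_apply']
    exact isWeightVector_normalizeWeights (by omega) fun s hs =>
      (mopMapM_mem hr ⟨ih.1 s hs, ih.le_one hs⟩).1

theorem isWeightVector_mopWeight {r : ℕ} (hr : 2 ≤ r) (n : ℕ) {ε : ℝ} (hε : 0 < ε)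
    (v : ℤ → ℝ) : IsWeightVector r (mopWeight r n ε v) := by
  refine isWeightVector_normalizeWeights (by omega) fun s hs => ?_
  have hjs := isWeightVector_jsWeight (by omega : 1 ≤ r) hε v
  have : ∀ k, 0 < (mopMapM r)^[k] (jsWeight r ε v s) ∧ (mopMapM r)^[k] (jsWeight r ε v s) ≤ 1 := by
    intro k
    induction k with
    | zero => exact ⟨hjs.1 s hs, hjs.le_one hs⟩
    | succ k ih =>
      rw [Function.iterate_succ_apply']
      exact mopMapM_mem hr ih
  exact (this n).1

theorem jsWeight_sub_isBigO {u : ℝ → ℝ} {z : ℝ} (hu : ContDiffAt ℝ ∞ u z) {m : ℕ}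
    (hz : IsCriticalOfOrder u z m) {r : ℕ} (hm : m + 1 < r) (K : ℝ) {s : ℕ} (hs : s < r) :
    (fun p : ℝ × ℝ × ℝ => jsWeight r p.2.2 (averages u p.1 p.2.1) s - idealWeight r s)
      =O[gridFilter z K] fun p => p.1 ^ (r - 1 - m) := by
  obtain ⟨B, hB, hβ⟩ := exists_smoothnessIndicator_sub_isBigO hu hz hm K
  have hg : Tendsto (fun p : ℝ × ℝ × ℝ => p.1 ^ (r - 1 - m)) (gridFilter z K) (𝓝 0) := by
    simpa [zero_pow (by omega : r - 1 - m ≠ 0)] using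
      (tendsto_fst_gridFilter z K).pow (r - 1 - m)
  -- Normalization ignores the common factor `(ε + B)²`, so only this ratio matters. Since `|y - 1|
  -- = |β - B| / (ε + B) ≤ |β - B| / B`, the bound is uniform in `ε`.
  set y : ℝ × ℝ × ℝ → ℕ → ℝ := fun p k =>
    (p.2.2 + smoothnessIndicator r (averages u p.1 p.2.1) k) / (p.2.2 + B p) with hy
  have hy1 : ∀ k, (fun p => y p k - 1) =O[gridFilter z K] fun p => p.1 ^ (r - 1 - m) := by
    intro k
    refine IsBigO.trans (.of_bound' ?_) (hβ k)
    filter_upwards [hB, eventually_mem_gridFilter z K] with p hB hp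
    have hε := hp.2.2.2
    rw [hy, div_sub_one (by positivity), add_sub_add_left_eq_sub, norm_div, norm_div,
      Real.norm_eq_abs (B p), Real.norm_eq_abs (_ + _), abs_of_pos hB, abs_of_pos (add_pos hε hB)]
    gcongr
    linarith
  have ha : ∀ k < r, (fun p => idealWeight r k / y p k ^ 2 - idealWeight r k)
      =O[gridFilter z K] fun p => p.1 ^ (r - 1 - m) := by
    intro k _
    have hdiff : DifferentiableAt ℝ (fun t : ℝ => idealWeight r k / t ^ 2) 1 := by
      fun_prop (disch := norm_num)
    have h1 : Tendsto (fun p => y p k) (gridFilter z K) (𝓝 1) :=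
      tendsto_sub_nhds_zero_iff.mp ((hy1 k).trans_tendsto hg)
    have h2 := (hdiff.isBigO_sub.comp_tendsto h1).trans (hy1 k)
    simpa [Function.comp_def] using h2
  refine (normalizeWeights_sub_isBigO (sum_idealWeight (by omega)) hg ha hs).congr' ?_
    EventuallyEq.rfl
  filter_upwards [hB, eventually_mem_gridFilter z K] with p hB hp
  have hε := hp.2.2.2
  have hne : (p.2.2 + B p) ^ 2 ≠ 0 := by positivity
  rw [jsWeight, ← normalizeWeights_const_mul r hne
    fun k => _ / (p.2.2 + smoothnessIndicator r (averages u p.1 p.2.1) k) ^ 2]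
  congr 2
  ext k
  rw [hy]
  field_simp

theorem mopMapM_comp_sub_isBigO {β : Type*} {l : Filter β} {r s : ℕ} (hr : 2 ≤ r) (hs : s < r)
    {w g : β → ℝ} (hg : Tendsto g l (𝓝 0)) (hw : (fun p => w p - idealWeight r s) =O[l] g) :
    (fun p => mopMapM r (w p) - idealWeight r s) =O[l] fun p => g p ^ 3 := by
  have h1 : Tendsto w l (𝓝 (idealWeight r s)) := tendsto_sub_nhds_zero_iff.mp (hw.trans_tendsto hg)
  exact ((mopMapM_sub_isBigO hr hs).comp_tendsto h1).trans (hw.pow 3)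

/-- Each mapping triples the order of accuracy of the weights; `W` is either of the two variants of
the MOP-WENO-M weights. -/
theorem mop_weights_sub_isBigO {u : ℝ → ℝ} {z : ℝ} (hu : ContDiffAt ℝ ∞ u z) {m : ℕ}
    (hz : IsCriticalOfOrder u z m) {r n : ℕ} (hr : 2 ≤ r)
    {W : ℝ → (ℤ → ℝ) → ℕ → ℝ} (hW : W = mopWeightRenorm r n ∨ W = mopWeight r n) (K : ℝ) {s : ℕ}
    (hs : s < r) :
    (fun p : ℝ × ℝ × ℝ => W p.2.2 (averages u p.1 p.2.1) s - idealWeight r s)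
      =O[gridFilter z K] fun p => p.1 ^ (3 ^ n * (r - 1 - m)) := by
  -- When `r ≤ m + 1` the exponent is `0`, and it suffices that both weights lie in `[0, 1]`.
  rcases le_or_gt r (m + 1) with hm | hm
  · rw [show r - 1 - m = 0 by omega, mul_zero]
    refine .of_bound 1 ?_
    filter_upwards [eventually_mem_gridFilter z K] with p hp
    have hw : IsWeightVector r (W p.2.2 (averages u p.1 p.2.1)) := by
      rcases hW with rfl | rfl
      · exact isWeightVector_mopWeightRenorm hr n hp.2.2.2 _
      · exact isWeightVector_mopWeight hr n hp.2.2.2 _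
    have h1 := hw.1 s hs
    have h2 := hw.le_one hs
    have h3 := idealWeight_pos hs
    have h4 := idealWeight_lt_one hr hs
    rw [pow_zero, norm_one, mul_one, Real.norm_eq_abs, abs_sub_le_iff]
    constructor <;> linarith
  · have hg : ∀ k, Tendsto (fun p : ℝ × ℝ × ℝ => p.1 ^ (3 ^ k * (r - 1 - m))) (gridFilter z K)
        (𝓝 0) := by
      intro k
      have h0 : 3 ^ k * (r - 1 - m) ≠ 0 := mul_ne_zero (by positivity) (by omega)
      simpa [zero_pow h0] using (tendsto_fst_gridFilter z K).pow (3 ^ k * (r - 1 - m))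
    have hcube : ∀ k, (fun p : ℝ × ℝ × ℝ => (p.1 ^ (3 ^ k * (r - 1 - m))) ^ 3)
        = fun p => p.1 ^ (3 ^ (k + 1) * (r - 1 - m)) := by
      intro k
      ext p
      rw [← pow_mul]
      congr 1
      ring
    have hsum : ∑ s ∈ range r, idealWeight r s = 1 := sum_idealWeight (by omega)
    rcases hW with rfl | rfl
    · induction n generalizing s with
      | zero => simpa [mopWeightRenorm] using jsWeight_sub_isBigO hu hz hm K hs
      | succ n ih =>
        simp only [mopWeightRenorm, Function.iterate_succ_apply']
        refine normalizeWeights_sub_isBigO hsum (hg _) (fun k hk => ?_) hs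
        rw [← hcube]
        exact mopMapM_comp_sub_isBigO hr hk (hg n) (ih hk)
    · refine normalizeWeights_sub_isBigO hsum (hg n) (fun k hk => ?_) hs
      induction n with
      | zero => simpa using jsWeight_sub_isBigO hu hz hm K hk
      | succ n ih =>
        simp only [Function.iterate_succ_apply']
        rw [← hcube]
        exact mopMapM_comp_sub_isBigO hr hk (hg n) ih

/-! ### The reconstructed values -/

/-- With `k = r - 1 - m`, the floor condition says `r ≤ 3^n k`. It decides which of `2r - 1` and
`3^n k + (r - 1)` is smaller, and the rate is that minimum. -/
theorem convergenceRate_le {r n m : ℕ} (hr : 1 ≤ r) (hm : m ≤ r - 1) :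
    convergenceRate r n m ≤ 2 * r - 1 ∧
      convergenceRate r n m ≤ 3 ^ n * (r - 1 - m) + (r - 1) := by
  obtain ⟨k, rfl⟩ : ∃ k, r = m + k + 1 := ⟨r - 1 - m, by omega⟩
  have hiff : (m : ℤ) ≤ ⌊((3 : ℝ) ^ n - 1) / 3 ^ n * (m + k + 1 : ℕ) - 1⌋
      ↔ m + k + 1 ≤ 3 ^ n * k := by
    have h3 : (0 : ℝ) < 3 ^ n := by positivity
    rw [Int.le_floor, ← Nat.cast_le (α := ℝ), le_sub_iff_add_le, div_mul_eq_mul_div,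
      le_div_iff₀ h3]
    push_cast
    constructor <;> intro h <;> nlinarith
  rw [convergenceRate]
  have e : (3 ^ n + 1) * (m + k + 1 - 1) - 3 ^ n * m = 3 ^ n * k + (m + k) := by
    rw [Nat.add_sub_cancel]
    refine Nat.sub_eq_of_eq_add ?_
    ring
  rw [e, show m + k + 1 - 1 - m = k by omega]
  split_ifs with h <;> rw [hiff] at h
  · omega
  · omega

theorem exists_uMinus_sub_isBigO {u : ℝ → ℝ} {z : ℝ} (hu : ContDiffAt ℝ ∞ u z) {m : ℕ}
    (hz : IsCriticalOfOrder u z m) {r n : ℕ} (hr : 2 ≤ r) (hm : m ≤ r - 1)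
    {W : ℝ → (ℤ → ℝ) → ℕ → ℝ} (hW : W = mopWeightRenorm r n ∨ W = mopWeight r n) :
    ∃ e : ℝ, ∀ K : ℝ, (fun p : ℝ × ℝ × ℝ => uMinus r (W p.2.2) u p.1 p.2.1
      - (u (p.2.1 + p.1 * (1 / 2)) + e * p.1 ^ (2 * r - 1)))
      =O[gridFilter z K] fun p => p.1 ^ (convergenceRate r n m + 1) := by
  obtain ⟨h1, h2⟩ := convergenceRate_le (n := n) (by omega : 1 ≤ r) hm
  obtain ⟨e, he⟩ := exists_eval_reconPoly_sub_isBigO hu (1 - r) (2 * r - 1)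
  refine ⟨e, fun K => ?_⟩
  have hfull := (he K).trans (isBigO_pow_gridFilter z K (Nat.add_le_add_right h1 1))
  have hweights : (fun p : ℝ × ℝ × ℝ => ∑ s ∈ range r,
      (W p.2.2 (averages u p.1 p.2.1) s - idealWeight r s)
        * (subValue r (averages u p.1 p.2.1) s - u (p.2.1 + p.1 * (1 / 2))))
      =O[gridFilter z K] fun p => p.1 ^ (convergenceRate r n m + 1) := by
    refine IsBigO.fun_sum fun s hs => ?_
    have h := (mop_weights_sub_isBigO hu hz hr hW K (mem_range.mp hs)).mul
      (subValue_sub_isBigO hu K r s)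
    simp only [← pow_add] at h
    exact h.trans (isBigO_pow_gridFilter z K (by omega))
  refine (hfull.add hweights).congr' ?_ EventuallyEq.rfl
  filter_upwards [eventually_mem_gridFilter z K] with p hp
  have hw : IsWeightVector r (W p.2.2 (averages u p.1 p.2.1)) := by
    rcases hW with rfl | rfl
    · exact isWeightVector_mopWeightRenorm hr n hp.2.2.2 _
    · exact isWeightVector_mopWeight hr n hp.2.2.2 _
  rw [← sum_idealWeight_mul_subValue r (by omega), uMinus, recon]
  simp only [sub_mul, mul_sub, sum_sub_distrib, ← sum_mul]
  rw [hw.2, sum_idealWeight (by omega)]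
  ring

/-- Under `y ↦ -y` the cell to the right of the edge, with centre `x + h`, becomes the base cell of
a left-biased reconstruction. -/
theorem uPlus_eq_uMinus_reflect (r : ℕ) (W : (ℤ → ℝ) → ℕ → ℝ) (u : ℝ → ℝ) (h x : ℝ) :
    uPlus r W u h x = uMinus r W (fun y => u (-y)) h (-(x + h)) := by
  rw [uPlus, uMinus]
  congr 1
  ext i
  rw [averages, averages, cellAverage, cellAverage, intervalIntegral.integral_comp_neg]
  push_cast
  congr 2 <;> ring

theorem IsCriticalOfOrder.reflect {u : ℝ → ℝ} {z : ℝ} {m : ℕ} (hz : IsCriticalOfOrder u z m) :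
    IsCriticalOfOrder (fun y => u (-y)) (-z) m := by
  refine ⟨fun k h1 h2 => ?_, ?_⟩
  · rw [iteratedDeriv_comp_neg, neg_neg, hz.1 k h1 h2, smul_zero]
  · rw [iteratedDeriv_comp_neg, neg_neg]
    exact smul_ne_zero (by simp) hz.2

theorem exists_uPlus_sub_isBigO {u : ℝ → ℝ} {z : ℝ} (hu : ContDiffAt ℝ ∞ u z) {m : ℕ}
    (hz : IsCriticalOfOrder u z m) {r n : ℕ} (hr : 2 ≤ r) (hm : m ≤ r - 1)
    {W : ℝ → (ℤ → ℝ) → ℕ → ℝ} (hW : W = mopWeightRenorm r n ∨ W = mopWeight r n) :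
    ∃ e : ℝ, ∀ K : ℝ, (fun p : ℝ × ℝ × ℝ => uPlus r (W p.2.2) u p.1 p.2.1
      - (u (p.2.1 + p.1 * (1 / 2)) + e * p.1 ^ (2 * r - 1)))
      =O[gridFilter z K] fun p => p.1 ^ (convergenceRate r n m + 1) := by
  have hu' : ContDiffAt ℝ ∞ (fun y => u (-y)) (-z) :=
    ContDiffAt.comp (-z) (by rwa [neg_neg]) contDiffAt_id.neg
  obtain ⟨e, he⟩ := exists_uMinus_sub_isBigO hu' hz.reflect hr hm hW
  refine ⟨e, fun K => ?_⟩
  refine ((he (K + 1)).comp_tendsto (tendsto_reflect_gridFilter z K)).congr_left fun p => ?_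
  simp only [Function.comp_apply, uPlus_eq_uMinus_reflect]
  ring_nf

/-! ### The numerical flux -/

theorem sub_isBigO_sub_of_tendsto {β : Type*} {l : Filter β} {f : ℝ → ℝ} {c : ℝ}
    (hf : ContDiffAt ℝ ∞ f c) {a b : β → ℝ} (ha : Tendsto a l (𝓝 c)) (hb : Tendsto b l (𝓝 c)) :
    (fun p => f (a p) - f (b p)) =O[l] fun p => a p - b p :=
  (hf.hasStrictDerivAt (by simp)).isBigO_sub.comp_tendsto (ha.prodMk_nhds hb)

/-- Mean value inequality for `y ↦ f (y + t) - f y`, whose derivative is `O(t)` because `f'` is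
locally Lipschitz. -/
theorem second_difference_isBigO {β : Type*} {l : Filter β} {f : ℝ → ℝ} {c : ℝ}
    (hf : ContDiffAt ℝ ∞ f c) {a b t : β → ℝ} (ha : Tendsto a l (𝓝 c)) (hb : Tendsto b l (𝓝 c))
    (ht : Tendsto t l (𝓝 0)) :
    (fun p => f (a p + t p) - f (a p) - (f (b p + t p) - f (b p)))
      =O[l] fun p => t p * (a p - b p) := by
  have hf2 : ContDiffAt ℝ 2 f c := mod_cast contDiffAt_infty.mp hf 2
  have hd : ContDiffAt ℝ 1 (deriv f) c := hf2.derivWithin (by norm_num)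
  obtain ⟨L, s, hs, hL⟩ := hd.exists_lipschitzOnWith
  have hdiff : ∀ᶠ y in 𝓝 c, DifferentiableAt ℝ f y ∧ y ∈ s :=
    ((hf2.eventually (by simp)).mono fun y hy => hy.differentiableAt (by simp)).and hs
  obtain ⟨δ, hδ, H⟩ := Metric.eventually_nhds_iff.mp hdiff
  refine .of_bound L ?_
  filter_upwards [ha.eventually (Metric.ball_mem_nhds c (half_pos hδ)),
    hb.eventually (Metric.ball_mem_nhds c (half_pos hδ)),
    ht.eventually (Metric.ball_mem_nhds 0 (half_pos hδ))] with p ha hb ht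
  have hmem : ∀ y ∈ Metric.ball c (δ / 2), dist y c < δ ∧ dist (y + t p) c < δ := by
    intro y hy
    rw [Metric.mem_ball, Real.dist_eq] at hy
    rw [Real.dist_eq, sub_zero] at ht
    rw [Real.dist_eq, Real.dist_eq]
    refine ⟨by linarith, ?_⟩
    calc |y + t p - c| = |(y - c) + t p| := by ring_nf
      _ ≤ |y - c| + |t p| := abs_add_le _ _
      _ < δ := by linarith
  have := (convex_ball c (δ / 2)).norm_image_sub_le_of_norm_hasDerivWithin_le
    (f := fun y => f (y + t p) - f y) (f' := fun y => deriv f (y + t p) - deriv f y)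
    (C := L * |t p|) (fun y hy => ?_) (fun y hy => ?_) hb ha
  · refine this.trans (le_of_eq ?_)
    rw [norm_mul, Real.norm_eq_abs (t p), mul_assoc]
  · obtain ⟨h1, h2⟩ := hmem y hy
    exact (((H h2).1.hasDerivAt.comp_add_const y (t p)).sub (H h1).1.hasDerivAt).hasDerivWithinAt
  · obtain ⟨h1, h2⟩ := hmem y hy
    have := hL.dist_le_mul _ (H h2).2 _ (H h1).2
    rwa [Real.dist_eq, Real.dist_eq, add_sub_cancel_left] at this

theorem tendsto_point_gridFilter {u : ℝ → ℝ} {z : ℝ} (hu : ContinuousAt u z) (K θ : ℝ) :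
    Tendsto (fun p : ℝ × ℝ × ℝ => u (p.2.1 + p.1 * θ)) (gridFilter z K) (𝓝 (u z)) := fun _ hs =>
  (eventually_forall_gridFilter (hu.eventually hs) K |θ|).mono fun _ hp => hp θ le_rfl

theorem cellAverage_deriv_eq {g : ℝ → ℝ} {z : ℝ} (hg : ContDiffAt ℝ ∞ g z) (K : ℝ) :
    ∀ᶠ p in gridFilter z K, cellAverage (deriv g) p.1 p.2.1
      = 1 / p.1 * (g (p.2.1 + p.1 * (1 / 2)) - g (p.2.1 + p.1 * (-(1 / 2)))) := by
  have hg2 : ContDiffAt ℝ 2 g z := mod_cast contDiffAt_infty.mp hg 2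
  have hev : ∀ᶠ y in 𝓝 z, DifferentiableAt ℝ g y ∧ ContinuousAt (deriv g) y :=
    (hg2.eventually (by simp)).mono fun y hy => ⟨hy.differentiableAt (by simp),
      (hy.derivWithin (m := 1) (by norm_num)).continuousAt⟩
  filter_upwards [eventually_forall_gridFilter hev K (1 / 2),
    eventually_mem_gridFilter z K] with p hp hp'
  have hpos := hp'.1
  have hI : ∀ y ∈ Set.uIcc (p.2.1 - p.1 / 2) (p.2.1 + p.1 / 2),
      DifferentiableAt ℝ g y ∧ ContinuousAt (deriv g) y := by
    intro y hy
    rw [Set.uIcc_of_le (by linarith)] at hy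
    have h1 : y = p.2.1 + p.1 * ((y - p.2.1) / p.1) := by field_simp; ring
    rw [h1]
    refine hp _ ?_
    rw [abs_div, abs_of_pos hpos, div_le_iff₀ hpos, abs_sub_le_iff]
    constructor <;> linarith [hy.1, hy.2]
  rw [cellAverage, intervalIntegral.integral_deriv_eq_sub (fun y hy => (hI y hy).1)
    (ContinuousOn.intervalIntegrable fun y hy => (hI y hy).2.continuousWithinAt)]
  congr 3 <;> ring

/-- The flux difference of two edge values with a common leading error term. -/
theorem edge_difference_isBigO {u f : ℝ → ℝ} {z : ℝ} (hu : ContDiffAt ℝ ∞ u z)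
    (hf : ContDiffAt ℝ ∞ f (u z)) {M N : ℕ} (hN : 1 ≤ N) (hNM : N ≤ M + 1) (hM : 1 ≤ M) {e : ℝ}
    {a : ℝ × ℝ × ℝ → ℝ}
    (ha : ∀ K : ℝ, (fun p : ℝ × ℝ × ℝ => a p - (u (p.2.1 + p.1 * (1 / 2)) + e * p.1 ^ M))
      =O[gridFilter z K] fun p => p.1 ^ N) (K : ℝ) :
    (fun p : ℝ × ℝ × ℝ => f (a p) - f (a (p.1, p.2.1 - p.1, p.2.2))
      - (f (u (p.2.1 + p.1 * (1 / 2))) - f (u (p.2.1 + p.1 * (-(1 / 2))))))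
      =O[gridFilter z K] fun p => p.1 ^ N := by
  have ha' : (fun p : ℝ × ℝ × ℝ => a (p.1, p.2.1 - p.1, p.2.2)
      - (u (p.2.1 + p.1 * (-(1 / 2))) + e * p.1 ^ M)) =O[gridFilter z K] fun p => p.1 ^ N := by
    refine ((ha (K + 1)).comp_tendsto (tendsto_shift_gridFilter z K)).congr_left fun p => ?_
    simp only [Function.comp_apply]
    ring_nf
  have h0 : ∀ k : ℕ, 1 ≤ k → Tendsto (fun p : ℝ × ℝ × ℝ => p.1 ^ k) (gridFilter z K) (𝓝 0) := by
    intro k hk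
    simpa [zero_pow (by omega : k ≠ 0)] using (tendsto_fst_gridFilter z K).pow k
  have ht : Tendsto (fun p : ℝ × ℝ × ℝ => e * p.1 ^ M) (gridFilter z K) (𝓝 0) := by
    simpa using (h0 M hM).const_mul e
  have hA : ∀ θ : ℝ, Tendsto (fun p : ℝ × ℝ × ℝ => u (p.2.1 + p.1 * θ)) (gridFilter z K)
      (𝓝 (u z)) := tendsto_point_gridFilter hu.continuousAt K
  have hAt : ∀ θ : ℝ, Tendsto (fun p : ℝ × ℝ × ℝ => u (p.2.1 + p.1 * θ) + e * p.1 ^ M)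
      (gridFilter z K) (𝓝 (u z)) := fun θ => by simpa using (hA θ).add ht
  have hlim : ∀ {b : ℝ × ℝ × ℝ → ℝ} {θ : ℝ}, (fun p : ℝ × ℝ × ℝ => b p
      - (u (p.2.1 + p.1 * θ) + e * p.1 ^ M)) =O[gridFilter z K] (fun p => p.1 ^ N) →
      Tendsto b (gridFilter z K) (𝓝 (u z)) := fun {b θ} hb => by
    simpa using (hb.trans_tendsto (h0 N hN)).add (hAt θ)
  have h1 := (sub_isBigO_sub_of_tendsto hf (hlim (ha K)) (hAt (1 / 2))).trans (ha K)
  have h2 := (sub_isBigO_sub_of_tendsto hf (hlim ha') (hAt (-(1 / 2)))).trans ha'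
  have h3 : (fun p : ℝ × ℝ × ℝ => u (p.2.1 + p.1 * (1 / 2)) - u (p.2.1 + p.1 * (-(1 / 2))))
      =O[gridFilter z K] fun p => p.1 := by
    have hid := fun θ => tendsto_point_gridFilter (u := id) (z := z) continuousAt_id K θ
    refine (sub_isBigO_sub_of_tendsto hu (hid (1 / 2)) (hid (-(1 / 2)))).trans ?_
    refine (isBigO_refl (fun p : ℝ × ℝ × ℝ => p.1) _).congr_left fun p => ?_
    simp only [id]
    ring
  -- The common shift `t = e h^M` acts at two points whose `u`-values differ by `O(h)`, so its net
  -- effect is `O(h^(M+1))`.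
  have h4 := (second_difference_isBigO hf (hA (1 / 2)) (hA (-(1 / 2))) ht).trans
    (((isBigO_refl (fun p : ℝ × ℝ × ℝ => p.1 ^ M) _).const_mul_left e).mul h3)
  simp only [← pow_succ] at h4
  refine ((h1.sub h2).add (h4.trans (isBigO_pow_gridFilter z K hNM))).congr_left fun p => ?_
  ring

theorem truncationError_isBigO {u : ℝ → ℝ} {z : ℝ} (hu : ContDiffAt ℝ ∞ u z) {m : ℕ}
    (hz : IsCriticalOfOrder u z m) {r n : ℕ} (hr : 2 ≤ r) (hm : m ≤ r - 1)
    {W : ℝ → (ℤ → ℝ) → ℕ → ℝ} (hW : W = mopWeightRenorm r n ∨ W = mopWeight r n)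
    {f : ℝ → ℝ} (hf : ContDiffAt ℝ ∞ f (u z)) (α K : ℝ) :
    (fun p : ℝ × ℝ × ℝ => truncationError r (W p.2.2) f α u p.1 p.2.1)
      =O[gridFilter z K] fun p => p.1 ^ convergenceRate r n m := by
  obtain ⟨e, he⟩ := exists_uMinus_sub_isBigO hu hz hr hm hW
  obtain ⟨e', he'⟩ := exists_uPlus_sub_isBigO hu hz hr hm hW
  have hle := (convergenceRate_le (n := n) (by omega : 1 ≤ r) hm).1
  have hedge := fun {g : ℝ → ℝ} (hg : ContDiffAt ℝ ∞ g (u z)) =>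
    edge_difference_isBigO hu hg (Nat.le_add_left 1 _) (Nat.add_le_add_right hle 1)
      (by omega) he K
  have hedge' := fun {g : ℝ → ℝ} (hg : ContDiffAt ℝ ∞ g (u z)) =>
    edge_difference_isBigO hu hg (Nat.le_add_left 1 _) (Nat.add_le_add_right hle 1)
      (by omega) he' K
  -- The dissipative part of the flux is handled by the same edge estimate with the identity as
  -- flux; there the exact edge differences cancel.
  have hsum := ((hedge hf).add (hedge' hf)).sub
    (((hedge' contDiffAt_id).sub (hedge contDiffAt_id)).const_mul_left α)
  have hinv := (isBigO_refl (fun p : ℝ × ℝ × ℝ => p.1⁻¹) (gridFilter z K)).mul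
    (hsum.const_mul_left (-(1 / 2)))
  refine hinv.congr' ?_ ?_
  · filter_upwards [cellAverage_deriv_eq (hf.comp z hu) K] with p hp
    have hp' : cellAverage (deriv fun y => f (u y)) p.1 p.2.1 = _ := hp
    rw [truncationError, hp', spatialOperator, numFlux, numFlux, laxFriedrichs, laxFriedrichs]
    simp only [id, Function.comp_apply]
    ring
  · filter_upwards [eventually_mem_gridFilter z K] with p hp
    rw [pow_succ', inv_mul_cancel_left₀ hp.1.ne']

end WENO

end

theorem mainTheorem4 (r n m : ℕ) (hr : 2 ≤ r) (hr9 : r ≤ 9) (hn : 1 ≤ n) (hm : m ≤ r - 1)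
    (W : ℝ → (ℤ → ℝ) → ℕ → ℝ)
    (hW : W = WENO.mopWeightRenorm r n ∨ W = WENO.mopWeight r n)
    (u : ℝ → ℝ) (z : ℝ) (hu : ContDiffAt ℝ ∞ u z) (hz : WENO.IsCriticalOfOrder u z m)
    (f : ℝ → ℝ) (hf : ContDiffAt ℝ ∞ f (u z)) (α : ℝ) (K : ℝ) :
    (∃ C : ℝ, ∃ h₀ > 0, ∀ h x ε : ℝ, 0 < h → h < h₀ → |x - z| ≤ K * h → 0 < ε →
      ∀ s < r, |W ε (WENO.averages u h x) s - WENO.idealWeight r s|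
        ≤ C * h ^ (3 ^ n * (r - 1 - m))) ∧
    (∃ C : ℝ, ∃ h₀ > 0, ∀ h x ε : ℝ, 0 < h → h < h₀ → |x - z| ≤ K * h → 0 < ε →
      |WENO.truncationError r (W ε) f α u h x|
        ≤ C * h ^ WENO.convergenceRate r n m) := by
  refine ⟨?_, WENO.isBigO_gridFilter_iff.mp
    (WENO.truncationError_isBigO hu hz hr hm hW hf α K)⟩
  -- Summing the absolute errors over `s` gives one constant and one threshold valid for all
  -- substencils.
  have hsum := Asymptotics.IsBigO.fun_sum (s := range r) fun s hs =>
    (WENO.mop_weights_sub_isBigO hu hz hr hW K (mem_range.mp hs)).norm_left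
  obtain ⟨C, h₀, h0, H⟩ := WENO.isBigO_gridFilter_iff.mp hsum
  refine ⟨C, h₀, h0, fun h x ε h1 h2 h3 h4 s hs => le_trans ?_ (H h x ε h1 h2 h3 h4)⟩
  refine le_trans ?_ (le_abs_self _)
  exact single_le_sum (f := fun s => ‖W ε (WENO.averages u h x) s - WENO.idealWeight r s‖)
    (fun _ _ => norm_nonneg _) (mem_range.mpr hs)
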